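/- **Proposition 2.1 (Existence, uniqueness, and stability).** Let $\Omega\subset\mathbb{R}^2$ be an open, connected, bounded polygon whose boundary is a simple closed polygonal line with corners $c_1,\dots,c_m$ (set $c_{m+1}:=c_1$) and straight edges $\Gamma_i=[c_i,c_{i+1}]$, $i=1,\dots,m$. Let $\mathcal{D}\subseteq\{1,\dots,m\}$ be nonempty, $\Gamma_{\mathcal{D}}:=\bigcup_{i\in\mathcal{D}}\Gamma_i$, and $$H^1_{\mathcal{D}}(\Omega):=\{v\in H^1(\Omega): v|_{\Gamma_{\mathcal{D}}}=0 \text{ in the sense of traces}\}.$$ Let $q\in\mathbb{N}_0$. Then there is a constant $C_q(\Omega)>0$, depending only on $\Omega$, $\mathcal{D}$ and $q$, such that $$\|v\|_{L^{2(q+1)}(\Omega)}\le C_q(\Omega)\,\|\nabla v\|_{L^2(\Omega)}\qquad\text{for all } v\in H^1_{\mathcal{D}}(\Omega). \tag{1}$$ Moreover, let $\lambda>0$ and $f\in L^{2(q+1)/(2q+1)}(\Omega)$. Consider the weak formulation of $-\Delta u+\lambda u^{2q+1}=f$ in $\Omega$ with $u=0$ on $\Gamma_{\mathcal{D}}$ and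 $\partial_n u=0$ on the remaining edges: find $u\in H^1_{\mathcal{D}}(\Omega)$ such that $$\int_\Omega\nabla u\cdot\nabla v\,dx+\lambda\int_\Omega u^{2q+1}v\,dx=\int_\Omega f v\,dx\qquad\text{for all } v\in H^1_{\mathcal{D}}(\Omega). \tag{2}$$ The integrals in (2) converge absolutely for all $u,v\in H^1_{\mathcal{D}}(\Omega)$, and (2) has exactly one solution $u\in H^1_{\mathcal{D}}(\Omega)$. This solution is stable in the sense that $$\|\nabla u\|_{L^2(\Omega)}\le\rho:=C_q(\Omega)\,\|f\|_{L^{2(q+1)/(2q+1)}(\Omega)}$$ for every constant $C_q(\Omega)>0$ for which (1) holds. -/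

import Mathlib

open MeasureTheory Filter Topology
open scoped ENNReal ContDiff

noncomputable section

namespace SemilinearBVP

/-- The Euclidean plane `ℝ²`. -/
abbrev Plane : Type := EuclideanSpace ℝ (Fin 2)

/-- `Ω` is the open bounded polygon with corners `P 0, …, P (m - 1)` (in cyclic order) and straight
edges joining consecutive corners.  The closed polygonal line formed by the edges is simple: running
through the half-open edges `[P i, P (i + 1))` one after the other, no point is met twice (which
forces `m ≥ 3`, and excludes the interior angles `0` and `2π`). -/
structure IsPolygonalDomain {m : ℕ} (P : Polygon Plane m) (Ω : Set Plane) : Prop where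
  simple : ∀ i j : Fin m, ∀ s ∈ Set.Ico (0 : ℝ) 1, ∀ t ∈ Set.Ico (0 : ℝ) 1,
    P.edgePath ℝ i s = P.edgePath ℝ j t → i = j ∧ s = t
  isOpen : IsOpen Ω
  isBounded : Bornology.IsBounded Ω
  isConnected : IsConnected Ω
  frontier_eq : frontier Ω = P.boundary ℝ

/-- The boundary part `⋃_{i ∈ D} Γ_i`, where `Γ_i` is the edge from corner `i` to corner `i + 1`. -/
def edgeUnion {m : ℕ} (P : Polygon Plane m) (D : Set (Fin m)) : Set Plane :=
  ⋃ i ∈ D, P.edgeSet ℝ i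

/-- The Lebesgue space `L^p(Ω)` of real functions. -/
abbrev LpSpace (Ω : Set Plane) (p : ℝ≥0∞) : Type :=
  Lp ℝ p (volume.restrict Ω : Measure Plane)

/-- The space `L²(Ω)²` of square-integrable vector fields, normed by `(∫_Ω |G|²)^{1/2}`. -/
abbrev L2Field (Ω : Set Plane) : Type :=
  Lp Plane 2 (volume.restrict Ω : Measure Plane)

/-- `G` is the weak gradient of `u` in `Ω`:
`∫_Ω u ∂_j φ = - ∫_Ω G_j φ` for all `φ ∈ C_c^∞(Ω)` and `j = 0, 1`. -/
def IsWeakGradient (Ω : Set Plane) (u : LpSpace Ω 2) (G : L2Field Ω) : Prop :=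
  ∀ φ : Plane → ℝ, ContDiff ℝ ∞ φ → HasCompactSupport φ → tsupport φ ⊆ Ω → ∀ j : Fin 2,
    ∫ x in Ω, u x * fderiv ℝ φ x (EuclideanSpace.single j 1) = - ∫ x in Ω, G x j * φ x

/-- The Sobolev space `H¹(Ω)`. -/
def H1 (Ω : Set Plane) : Set (LpSpace Ω 2) :=
  {u | ∃ G : L2Field Ω, IsWeakGradient Ω u G}

open Classical in
/-- The weak gradient `∇u` of `u ∈ H¹(Ω)` (and `0` if `u ∉ H¹(Ω)`). -/
def weakGrad (Ω : Set Plane) (u : LpSpace Ω 2) : L2Field Ω :=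
  if h : ∃ G : L2Field Ω, IsWeakGradient Ω u G then h.choose else 0

theorem isWeakGradient_weakGrad {Ω : Set Plane} {u : LpSpace Ω 2} (hu : u ∈ H1 Ω) :
    IsWeakGradient Ω u (weakGrad Ω u) := by
  have h : ∃ G : L2Field Ω, IsWeakGradient Ω u G := hu
  rw [weakGrad, dif_pos h]
  exact h.choose_spec

/-- Weak gradients are unique, so that `weakGrad` does not depend on a choice. -/
theorem IsWeakGradient.unique {Ω : Set Plane} (hΩ : IsOpen Ω) {u : LpSpace Ω 2} {G H : L2Field Ω}
    (hG : IsWeakGradient Ω u G) (hH : IsWeakGradient Ω u H) : G = H := by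
  have key : ∀ j : Fin 2, ∀ᵐ x ∂(volume.restrict Ω : Measure Plane), G x j = H x j := by
    intro j
    have cG : ∀ F : L2Field Ω, LocallyIntegrable (fun x => F x j) (volume.restrict Ω) := by
      intro F
      have h1 : MemLp (fun x => F x j) 2 (volume.restrict Ω) :=
        (EuclideanSpace.proj (𝕜 := ℝ) j).comp_memLp' (Lp.memLp F)
      exact h1.locallyIntegrable (by norm_num)
    have hloc : LocallyIntegrable (fun x => G x j - H x j) (volume.restrict Ω) :=
      (cG G).sub (cG H)
    have h0 := hΩ.ae_eq_zero_of_integral_contDiff_smul_eq_zero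
      (hloc.locallyIntegrableOn Ω) (by
        intro g hg hgc hgs
        have e1 := hG g hg hgc hgs j
        have e2 := hH g hg hgc hgs j
        have e3 : ∫ x in Ω, G x j * g x = ∫ x in Ω, H x j * g x := by linarith
        have i1 : ∀ F : L2Field Ω, Integrable (fun x => F x j * g x) (volume.restrict Ω) := by
          intro F
          have := (cG F).integrable_smul_left_of_hasCompactSupport hg.continuous hgc
          simpa [mul_comm] using this
        have e4 := integral_sub (i1 G) (i1 H)
        rw [e3, sub_self] at e4
        rw [← e4]
        congr 1
        ext x
        simp [mul_comm, mul_sub])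
    have hmem : ∀ᵐ x ∂(volume.restrict Ω : Measure Plane), x ∈ Ω :=
      ae_restrict_mem hΩ.measurableSet
    filter_upwards [h0, hmem] with x hx hxm
    exact sub_eq_zero.mp (hx hxm)
  apply Lp.ext
  filter_upwards [key 0, key 1] with x h0 h1
  ext j
  fin_cases j
  · exact h0
  · exact h1

/-- `g` is the trace of `u ∈ H¹(Ω)` on the boundary part `S ⊆ ∂Ω`.  The trace operator is the
continuous extension to `H¹(Ω)` of the restriction `φ ↦ φ|_S ∈ L²(S)` of functions `φ` that are
smooth up to the boundary: some smooth `φ_n` converge to `u` in `H¹(Ω)`, and their restrictions to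
`S` converge to `g` in `L²(S)`, with respect to arc length (one-dimensional Hausdorff measure). -/
def HasTrace (Ω S : Set Plane) (u : LpSpace Ω 2) (g : Plane → ℝ) : Prop :=
  u ∈ H1 Ω ∧ MemLp g 2 ((μH[1] : Measure Plane).restrict S) ∧
  ∃ φ : ℕ → Plane → ℝ, (∀ n, ContDiff ℝ ∞ (φ n)) ∧
    Tendsto (fun n => eLpNorm (fun x => φ n x - u x) 2 (volume.restrict Ω)) atTop (𝓝 0) ∧
    Tendsto (fun n => eLpNorm (fun x => gradient (φ n) x - weakGrad Ω u x) 2 (volume.restrict Ω))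
      atTop (𝓝 0) ∧
    Tendsto (fun n => eLpNorm (fun x => φ n x - g x) 2 ((μH[1] : Measure Plane).restrict S))
      atTop (𝓝 0)

/-- The space `H¹_D(Ω)` of all `v ∈ H¹(Ω)` with zero trace on `Γ_D = ⋃_{i ∈ D} Γ_i`. -/
def H1D {m : ℕ} (P : Polygon Plane m) (D : Set (Fin m)) (Ω : Set Plane) : Set (LpSpace Ω 2) :=
  {v | v ∈ H1 Ω ∧ HasTrace Ω (edgeUnion P D) v 0}

/-- `a(v, w) = ∫_Ω ∇v · ∇w`. -/
def formA (Ω : Set Plane) (v w : LpSpace Ω 2) : ℝ :=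
  ∫ x in Ω, inner ℝ (weakGrad Ω v x) (weakGrad Ω w x)

/-- `b(u; v) = ∫_Ω u^{2q+1} v`. -/
def formB (Ω : Set Plane) (q : ℕ) (u v : LpSpace Ω 2) : ℝ :=
  ∫ x in Ω, (u x) ^ (2 * q + 1) * v x

/-- The exponent `2(q+1)`. -/
def expo (q : ℕ) : ℝ≥0∞ := ((2 * (q + 1) : ℕ) : ℝ≥0∞)

/-- The exponent `2(q+1)/(2q+1)`, conjugate to `2(q+1)`. -/
def conjExpo (q : ℕ) : ℝ≥0∞ := ((2 * (q + 1) : ℕ) : ℝ≥0∞) / ((2 * q + 1 : ℕ) : ℝ≥0∞)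

/-- `C > 0` is a constant in the Sobolev embedding bound
`‖v‖_{L^{2(q+1)}(Ω)} ≤ C ‖∇v‖_{L²(Ω)}` for all `v ∈ H¹_D(Ω)`. -/
def IsSobolevConstant {m : ℕ} (P : Polygon Plane m) (D : Set (Fin m)) (Ω : Set Plane) (q : ℕ)
    (C : ℝ) : Prop :=
  0 < C ∧ ∀ v ∈ H1D P D Ω,
    eLpNorm v (expo q) (volume.restrict Ω) ≤ ENNReal.ofReal (C * ‖weakGrad Ω v‖)

/-- `u ∈ H¹_D(Ω)` solves the weak formulation
`a(u, v) + λ b(u; v) = ∫_Ω f v` for all `v ∈ H¹_D(Ω)` (here `lam` is `λ`). -/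
def IsWeakSolution {m : ℕ} (P : Polygon Plane m) (D : Set (Fin m)) (Ω : Set Plane) (q : ℕ)
    (lam : ℝ) (f : LpSpace Ω (conjExpo q)) (u : LpSpace Ω 2) : Prop :=
  u ∈ H1D P D Ω ∧
    ∀ v ∈ H1D P D Ω, formA Ω u v + lam * formB Ω q u v = ∫ x in Ω, f x * v x

end SemilinearBVP

end

open SemilinearBVP

/-! The Sobolev bound rests on one potential estimate. On a bounded open convex set `K`, integrating
the derivative along segments and changing variables bounds `|φ(x) - avg_K φ|` by a multiple of `∫_K
|Dφ(z)| / |x - z| dz`, for every `x` in the closure of `K` (`setLIntegral_enorm_sub_le_potential`).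
A Hölder argument turns this into an `L²`-to-`L^p(μ)` bound for any measure `μ` on the closure
against which a suitable power of `1/|x - z|` integrates uniformly
(`exists_eLpNorm_sub_setAverage_le`). Area measure gives Sobolev–Poincaré for every finite `p ≥ 2`;
arc length gives a trace inequality.

The lines through the edges cut the polygon into finitely many convex cells, up to a null set.
Connectedness of `Ω` makes their averages comparable, and a Dirichlet edge meets the closure of some
cell in positive length, which controls that cell's average by the derivative and the boundary
values. This proves the bound for smooth functions; the approximations in `HasTrace` and Fatou's
lemma carry it to `H1D`.

For the equation, the pairs `(u, ∇u)` with zero trace form a closed subspace of `L² × L²`, on which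
the case `q = 0` of the bound is a Poincaré inequality. The energy `‖∇u‖²/2 + λ/(2(q+1))
‖u‖^{2(q+1)} - ∫ f u` is bounded below there, and its quadratic part makes minimizing sequences
Cauchy (`exists_forall_half_sq_norm_add_le`). One-sided variations in the directions `v` and `-v`
give the weak equation. Uniqueness follows from monotonicity of odd powers, and stability from
testing with `u`. -/

noncomputable section

namespace SemilinearBVP

/-! ### Kernel bounds for potentials -/

/-- Hölder bound for integral operators: from `L²` to `L^p`. -/
theorem lintegral_rpow_lintegral_mul_le {X Y : Type*} [MeasurableSpace X] [MeasurableSpace Y]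
    {μ : Measure X} {ν : Measure Y} [SFinite μ] [SFinite ν] {g : Y → ℝ≥0∞} {k : X → Y → ℝ≥0∞}
    (hg : Measurable g) (hk : Measurable (Function.uncurry k)) {p α β : ℝ} (hp : 2 ≤ p)
    (hα : 0 ≤ α) (hβ : 0 ≤ β) (hαβ : α / p + β / 2 = 1) {A B : ℝ≥0∞}
    (hA : ∀ y, ∫⁻ x, k x y ^ α ∂μ ≤ A) (hB : ∀ x, ∫⁻ y, k x y ^ β ∂ν ≤ B) :
    ∫⁻ x, (∫⁻ y, g y * k x y ∂ν) ^ p ∂μ ≤ A * B ^ (p / 2) * (∫⁻ y, g y ^ (2 : ℝ) ∂ν) ^ (p / 2) := by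
  have hp0 : 0 < p := by linarith
  have h1p : 0 ≤ 1 / 2 - 1 / p := by
    have := one_div_le_one_div_of_le (by norm_num) hp
    linarith
  set N := ∫⁻ y, g y ^ (2 : ℝ) ∂ν with hN
  have hkx : ∀ x, Measurable (k x) := fun x => hk.comp measurable_prodMk_left
  have hky : ∀ y, Measurable (fun x => k x y) := fun y => hk.comp measurable_prodMk_right
  have pt : ∀ x, (∫⁻ y, g y * k x y ∂ν) ^ p
      ≤ (∫⁻ y, g y ^ (2 : ℝ) * k x y ^ α ∂ν) * (N ^ (p / 2 - 1) * B ^ (p / 2)) := by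
    intro x
    -- Three-factor Hölder for the splitting `g k = (g² k^α)^{1/p} (g²)^{1/2 - 1/p} (k^β)^{1/2}`.
    -- Only the first factor keeps its dependence on `x` after the bounds by `N` and `B`, and
    -- Tonelli then integrates it.
    have h := ENNReal.lintegral_prod_norm_pow_le (μ := ν) (Finset.univ : Finset (Fin 3))
      (f := ![fun y => g y ^ (2 : ℝ) * k x y ^ α, fun y => g y ^ (2 : ℝ), fun y => k x y ^ β])
      (p := ![1 / p, 1 / 2 - 1 / p, 1 / 2])
      (by
        intro i _
        fin_cases i
        · exact ((hg.pow_const _).mul ((hkx x).pow_const _)).aemeasurable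
        · exact (hg.pow_const _).aemeasurable
        · exact ((hkx x).pow_const _).aemeasurable)
      (by simp [Fin.sum_univ_three]; norm_num)
      (by
        intro i _
        fin_cases i
        · simp [hp0.le]
        · simpa using h1p
        · simp)
    simp only [Fin.prod_univ_three, Matrix.cons_val_zero, Matrix.cons_val_one, Matrix.cons_val] at h
    have e : ∀ y, (g y ^ (2 : ℝ) * k x y ^ α) ^ (1 / p) * (g y ^ (2 : ℝ)) ^ (1 / 2 - 1 / p)
        * (k x y ^ β) ^ (1 / 2 : ℝ) = g y * k x y := by
      intro y
      rw [ENNReal.mul_rpow_of_nonneg _ _ (by positivity), ← ENNReal.rpow_mul, ← ENNReal.rpow_mul,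
        ← ENNReal.rpow_mul, ← ENNReal.rpow_mul, mul_right_comm (g y ^ _), mul_assoc,
        ← ENNReal.rpow_add_of_nonneg _ _ (by positivity) (by positivity),
        ← ENNReal.rpow_add_of_nonneg _ _ (by positivity) (by positivity)]
      have e1 : 2 * (1 / p) + 2 * (1 / 2 - 1 / p) = 1 := by ring
      have e2 : α * (1 / p) + β * (1 / 2) = 1 := by linear_combination hαβ
      rw [e1, e2, ENNReal.rpow_one, ENNReal.rpow_one]
    simp only [e] at h
    calc (∫⁻ y, g y * k x y ∂ν) ^ p
        ≤ ((∫⁻ y, g y ^ (2 : ℝ) * k x y ^ α ∂ν) ^ (1 / p) * N ^ (1 / 2 - 1 / p)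
            * (∫⁻ y, k x y ^ β ∂ν) ^ (1 / 2 : ℝ)) ^ p := by gcongr
      _ = (∫⁻ y, g y ^ (2 : ℝ) * k x y ^ α ∂ν) * N ^ (p / 2 - 1)
            * (∫⁻ y, k x y ^ β ∂ν) ^ (p / 2) := by
          rw [ENNReal.mul_rpow_of_nonneg _ _ hp0.le, ENNReal.mul_rpow_of_nonneg _ _ hp0.le,
            ← ENNReal.rpow_mul, ← ENNReal.rpow_mul, ← ENNReal.rpow_mul]
          have e1 : 1 / p * p = 1 := by field_simp
          have e2 : (1 / 2 - 1 / p) * p = p / 2 - 1 := by field_simp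
          have e3 : 1 / 2 * p = p / 2 := by ring
          rw [e1, e2, e3, ENNReal.rpow_one]
      _ ≤ _ := by
          rw [mul_assoc]
          gcongr
          exact hB x
  have hm : Measurable (Function.uncurry fun x y => g y ^ (2 : ℝ) * k x y ^ α) :=
    ((hg.comp measurable_snd).pow_const _).mul (hk.pow_const _)
  calc ∫⁻ x, (∫⁻ y, g y * k x y ∂ν) ^ p ∂μ
      ≤ ∫⁻ x, (∫⁻ y, g y ^ (2 : ℝ) * k x y ^ α ∂ν) * (N ^ (p / 2 - 1) * B ^ (p / 2)) ∂μ :=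
        lintegral_mono pt
    _ = (∫⁻ x, ∫⁻ y, g y ^ (2 : ℝ) * k x y ^ α ∂ν ∂μ) * (N ^ (p / 2 - 1) * B ^ (p / 2)) :=
        lintegral_mul_const _ hm.lintegral_prod_right'
    _ = (∫⁻ y, ∫⁻ x, g y ^ (2 : ℝ) * k x y ^ α ∂μ ∂ν) * (N ^ (p / 2 - 1) * B ^ (p / 2)) := by
        rw [lintegral_lintegral_swap hm.aemeasurable]
    _ ≤ (∫⁻ y, g y ^ (2 : ℝ) * A ∂ν) * (N ^ (p / 2 - 1) * B ^ (p / 2)) := by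
        gcongr with y
        rw [lintegral_const_mul _ ((hky y).pow_const _)]
        gcongr
        exact hA y
    _ = A * B ^ (p / 2) * (N * N ^ (p / 2 - 1)) := by
        rw [lintegral_mul_const _ (hg.pow_const _), ← hN]
        ring
    _ = A * B ^ (p / 2) * N ^ (p / 2) := by
        congr 1
        nth_rewrite 1 [← ENNReal.rpow_one N]
        rw [← ENNReal.rpow_add_of_nonneg _ _ zero_le_one (by linarith)]
        congr 1
        ring

/-- The kernel `|x - z|^{-α}` with `α < dim E` is integrable over sets of finite measure, uniformly
in `z`. -/
theorem exists_setLIntegral_inv_enorm_sub_rpow_le {E : Type*} [NormedAddCommGroup E]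
    [NormedSpace ℝ E] [FiniteDimensional ℝ E] [MeasurableSpace E] [BorelSpace E] (μ : Measure E)
    [μ.IsAddHaarMeasure] (hE : 1 ≤ Module.finrank ℝ E) {α : ℝ} (hα : 0 ≤ α)
    (hαE : α < Module.finrank ℝ E) {S : Set E} (hS : MeasurableSet S) (hμS : μ S ≠ ⊤) :
    ∃ B : ℝ≥0∞, B ≠ ⊤ ∧ ∀ z, ∫⁻ x in S, (‖x - z‖ₑ⁻¹) ^ α ∂μ ≤ B := by
  have : Nontrivial E := Module.nontrivial_of_finrank_pos (R := ℝ) (by omega)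
  have hint : IntegrableOn (fun x : E => ‖x‖ ^ (-α)) (Metric.ball 0 1) μ := by
    refine integrableOn_ball_of_norm_le_rpow (C := 1) hE hαE ?_ ?_
    · filter_upwards with x
      rw [one_mul, Real.norm_of_nonneg (by positivity)]
    · exact (measurable_norm.pow_const _).aestronglyMeasurable
  have hball : ∫⁻ x in Metric.ball (0 : E) 1, (‖x‖ₑ⁻¹) ^ α ∂μ ≠ ⊤ := by
    have e : ∫⁻ x in Metric.ball (0 : E) 1, (‖x‖ₑ⁻¹) ^ α ∂μ
        = ∫⁻ x in Metric.ball (0 : E) 1, ‖‖x‖ ^ (-α)‖ₑ ∂μ := by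
      apply lintegral_congr_ae
      have h0 : ∀ᵐ x ∂(μ.restrict (Metric.ball (0 : E) 1)), x ≠ 0 :=
        ae_restrict_of_ae (compl_mem_ae_iff.mpr (measure_singleton 0))
      filter_upwards [h0] with x hx
      have hx' : 0 < ‖x‖ := norm_pos_iff.mpr hx
      rw [Real.enorm_of_nonneg (by positivity), ← ENNReal.ofReal_rpow_of_pos hx', ofReal_norm,
        ENNReal.rpow_neg, ENNReal.inv_rpow]
    rw [e]
    exact hint.2.ne
  -- Within distance 1 of `z` the kernel is translated to the unit ball at 0; farther away it is at
  -- most 1 and contributes at most `μ S`.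
  refine ⟨∫⁻ x in Metric.ball (0 : E) 1, (‖x‖ₑ⁻¹) ^ α ∂μ + μ S,
    ENNReal.add_ne_top.mpr ⟨hball, hμS⟩, fun z => ?_⟩
  have hm : Measurable fun x : E => (‖x‖ₑ⁻¹) ^ α := by fun_prop
  rw [← lintegral_indicator hS, ← lintegral_indicator Metric.isOpen_ball.measurableSet,
    ← lintegral_sub_right_eq_self ((Metric.ball (0 : E) 1).indicator _) z, ← lintegral_indicator_one hS,
    ← lintegral_add_right _ (measurable_one.indicator hS)]
  refine lintegral_mono fun x => ?_
  by_cases hx : x ∈ S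
  · by_cases hxz : x - z ∈ Metric.ball (0 : E) 1
    · simp [Set.indicator_of_mem hx, Set.indicator_of_mem hxz]
    · rw [Set.indicator_of_mem hx, Set.indicator_of_mem hx, Set.indicator_of_notMem hxz, zero_add]
      have h1 : 1 ≤ ‖x - z‖ₑ := by
        rw [← ofReal_norm, ENNReal.one_le_ofReal]
        simpa using hxz
      exact ENNReal.rpow_le_one (ENNReal.inv_le_one.mpr h1) hα
  · simp [Set.indicator_of_notMem hx]

/-! ### Potential estimate on convex sets -/

theorem lintegral_comp_homothety {F : Plane → ℝ≥0∞} (hF : Measurable F) (x : Plane) {t : ℝ}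
    (ht : 0 < t) :
    ∫⁻ y, F (x + t • (y - x)) = ENNReal.ofReal ((t ^ 2)⁻¹) * ∫⁻ z, F z := by
  have e : ∀ y, F (x + t • (y - x)) = (fun w => F (w + (x - t • x))) (t • y) := by
    intro y
    simp only
    congr 1
    rw [smul_sub]
    abel
  simp only [e]
  have hF' : Measurable fun w => F (w + (x - t • x)) := by fun_prop
  rw [← lintegral_map (g := fun y : Plane => t • y) hF' (measurable_const_smul t),
    Measure.map_addHaar_smul _ ht.ne', lintegral_smul_measure, lintegral_add_right_eq_self,
    abs_of_pos (by positivity)]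
  simp

theorem lintegral_Ioi_inv_pow_three {s : ℝ} (hs : 0 < s) :
    ∫⁻ t in Set.Ioi s, ENNReal.ofReal ((t ^ 3)⁻¹) = ENNReal.ofReal ((s ^ 2)⁻¹ / 2) := by
  have e : ∀ t ∈ Set.Ioi s, (t ^ 3)⁻¹ = t ^ (-3 : ℝ) := by
    intro t ht
    rw [Real.rpow_neg (hs.trans ht).le]
    norm_cast
  rw [setLIntegral_congr_fun measurableSet_Ioi fun t ht => by rw [e t ht],
    ← ofReal_integral_eq_lintegral_ofReal (integrableOn_Ioi_rpow_of_lt (by norm_num) hs)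
      ((ae_restrict_mem measurableSet_Ioi).mono fun t ht =>
        Real.rpow_nonneg (hs.trans ht).le _),
    integral_Ioi_rpow_of_lt (by norm_num) hs]
  have h2 : s ^ (-2 : ℝ) = (s ^ 2)⁻¹ := by
    rw [Real.rpow_neg hs.le]
    norm_cast
  rw [show (-3 : ℝ) + 1 = -2 by norm_num, h2]
  congr 1
  ring

theorem enorm_sub_le_lintegral_fderiv {φ : Plane → ℝ} (hφ : ContDiff ℝ 1 φ) (x y : Plane) :
    ‖φ x - φ y‖ₑ ≤ ∫⁻ t in Set.Ioc (0 : ℝ) 1, ‖fderiv ℝ φ (x + t • (y - x))‖ₑ * ‖y - x‖ₑ := by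
  have hd : ∀ t : ℝ, HasDerivAt (fun t : ℝ => φ (x + t • (y - x)))
      (fderiv ℝ φ (x + t • (y - x)) (y - x)) t := by
    intro t
    have h1 : HasDerivAt (fun t : ℝ => x + t • (y - x)) (y - x) t := by
      simpa using ((hasDerivAt_id t).smul_const (y - x)).const_add x
    exact ((hφ.differentiable one_ne_zero _).hasFDerivAt).comp_hasDerivAt t h1
  have hc : Continuous fun t : ℝ => fderiv ℝ φ (x + t • (y - x)) (y - x) :=
    ((hφ.continuous_fderiv one_ne_zero).comp (by fun_prop)).clm_apply continuous_const
  have h := intervalIntegral.integral_eq_sub_of_hasDerivAt (fun t _ => hd t)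
    (hc.intervalIntegrable 0 1)
  simp only [one_smul, add_sub_cancel, zero_smul, add_zero] at h
  rw [enorm_sub_rev, ← h, intervalIntegral.integral_of_le zero_le_one]
  refine (enorm_integral_le_lintegral_enorm _).trans ?_
  gcongr with t
  exact ContinuousLinearMap.le_opENorm _ _

/-- The density produced by contracting a set of diameter `d` towards `x`. -/
def contractionKernel (x : Plane) (d t : ℝ) (z : Plane) : ℝ≥0∞ :=
  {q : ℝ × Plane | ‖q.2 - x‖ < q.1 * d}.indicator (fun q => ENNReal.ofReal ((q.1 ^ 3)⁻¹)) (t, z)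

theorem measurable_contractionKernel (x : Plane) (d : ℝ) :
    Measurable (Function.uncurry (contractionKernel x d)) := by
  have hset : MeasurableSet {q : ℝ × Plane | ‖q.2 - x‖ < q.1 * d} :=
    measurableSet_lt (by fun_prop) (by fun_prop)
  exact Measurable.indicator (by fun_prop) hset

/-- Only times `t > ‖z - x‖ / d` contribute, and `∫ t⁻³` over that half-line is of order `d² / ‖z -
x‖²`. -/
theorem setLIntegral_contractionKernel_le (x : Plane) {d : ℝ} (hd : 0 < d) {z : Plane}
    (hz : z ≠ x) :
    ∫⁻ t in Set.Ioc (0 : ℝ) 1, contractionKernel x d t z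
      ≤ ENNReal.ofReal (d ^ 2 / ‖z - x‖ ^ 2) := by
  have ha : 0 < ‖z - x‖ := norm_pos_iff.mpr (sub_ne_zero.mpr hz)
  calc ∫⁻ t in Set.Ioc (0 : ℝ) 1, contractionKernel x d t z
      ≤ ∫⁻ t, (Set.Ioi (‖z - x‖ / d)).indicator (fun t => ENNReal.ofReal ((t ^ 3)⁻¹)) t := by
        refine (setLIntegral_le_lintegral _ _).trans (lintegral_mono fun t => ?_)
        by_cases h : ‖z - x‖ < t * d
        · have h' : t ∈ Set.Ioi (‖z - x‖ / d) := by rwa [Set.mem_Ioi, div_lt_iff₀ hd]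
          simp [contractionKernel, h, Set.indicator_of_mem h']
        · simp [contractionKernel, h]
    _ = ENNReal.ofReal (((‖z - x‖ / d) ^ 2)⁻¹ / 2) := by
        rw [lintegral_indicator measurableSet_Ioi, lintegral_Ioi_inv_pow_three (by positivity)]
    _ ≤ _ := by
        apply ENNReal.ofReal_le_ofReal
        rw [div_pow, inv_div]
        exact half_le_self (by positivity)

theorem setLIntegral_contractionKernel_mul_le {x z : Plane} {d : ℝ} (hd : ‖z - x‖ < d)
    (c : ℝ≥0∞) :
    (∫⁻ t in Set.Ioc (0 : ℝ) 1, contractionKernel x d t z) * (c * ‖z - x‖ₑ)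
      ≤ ENNReal.ofReal (d ^ 2) * (c * ‖x - z‖ₑ⁻¹) := by
  rcases eq_or_ne z x with rfl | hzx
  · simp
  have ha : 0 < ‖z - x‖ := norm_pos_iff.mpr (sub_ne_zero.mpr hzx)
  have hd0 : 0 < d := ha.trans hd
  have e : ENNReal.ofReal (d ^ 2 / ‖z - x‖ ^ 2) * ‖z - x‖ₑ
      = ENNReal.ofReal (d ^ 2) * ‖x - z‖ₑ⁻¹ := by
    rw [enorm_sub_rev x z, ← ofReal_norm, ← ENNReal.ofReal_inv_of_pos ha,
      ← ENNReal.ofReal_mul (by positivity), ← ENNReal.ofReal_mul (by positivity)]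
    congr 1
    field_simp
  calc (∫⁻ t in Set.Ioc (0 : ℝ) 1, contractionKernel x d t z) * (c * ‖z - x‖ₑ)
      ≤ ENNReal.ofReal (d ^ 2 / ‖z - x‖ ^ 2) * (c * ‖z - x‖ₑ) := by
        gcongr
        exact setLIntegral_contractionKernel_le x hd0 hzx
    _ = _ := by rw [mul_left_comm, e, mul_left_comm]

/-- Substitute `z = x + t(y - x)`. The Jacobian gives `t⁻²` and `‖y - x‖ = ‖z - x‖ / t` gives
another `t⁻¹`, whence the `t⁻³` in the kernel; the image lies in `K` and within distance `t d` of
`x`. -/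
theorem setLIntegral_comp_homothety_le {K : Set Plane} (hK : IsOpen K) (hKc : Convex ℝ K)
    {F : Plane → ℝ≥0∞} (hF : Measurable F) {x : Plane} (hx : x ∈ closure K) {d : ℝ}
    (hd : ∀ y ∈ K, ‖y - x‖ < d) {t : ℝ} (ht : t ∈ Set.Ioc (0 : ℝ) 1) :
    ∫⁻ y in K, F (x + t • (y - x)) * ‖y - x‖ₑ
      ≤ ∫⁻ z in K, contractionKernel x d t z * (F z * ‖z - x‖ₑ) := by
  have hHm : Measurable (K.indicator fun z => contractionKernel x d t z * (F z * ‖z - x‖ₑ)) :=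
    (((measurable_contractionKernel x d).comp measurable_prodMk_left).mul
      (hF.mul (by fun_prop))).indicator hK.measurableSet
  rw [← lintegral_indicator hK.measurableSet (f := fun z =>
    contractionKernel x d t z * (F z * ‖z - x‖ₑ))]
  generalize hH : (K.indicator fun z => contractionKernel x d t z * (F z * ‖z - x‖ₑ)) = H at hHm ⊢
  have hcv : ∫⁻ z, H z = ENNReal.ofReal (t ^ 2) * ∫⁻ y, H (x + t • (y - x)) := by
    rw [lintegral_comp_homothety hHm x ht.1, ← mul_assoc, ← ENNReal.ofReal_mul (by positivity),
      mul_inv_cancel₀ (pow_ne_zero _ ht.1.ne'), ENNReal.ofReal_one, one_mul]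
  rw [hcv, ← lintegral_const_mul _ (by fun_prop), ← lintegral_indicator hK.measurableSet]
  refine lintegral_mono fun y => ?_
  by_cases hy : y ∈ K
  -- Since `x` is only in the closure of `K`, convexity alone is not enough: the open segment from a
  -- closure point to an interior point stays in the interior.
  · have hmem : x + t • (y - x) ∈ K := by
      rcases ht.2.eq_or_lt with h1 | h1
      · simpa [h1] using hy
      · have := hKc.openSegment_closure_interior_subset_interior hx
          (by rwa [hK.interior_eq] : y ∈ interior K)
        rw [hK.interior_eq] at this
        apply this
        refine ⟨1 - t, t, by linarith, ht.1, by ring, ?_⟩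
        rw [sub_smul, one_smul, smul_sub]
        abel
    have hlt : (t, x + t • (y - x)) ∈ {q : ℝ × Plane | ‖q.2 - x‖ < q.1 * d} := by
      simp only [Set.mem_ofPred_eq, add_sub_cancel_left, norm_smul, Real.norm_of_nonneg ht.1.le]
      exact mul_lt_mul_of_pos_left (hd y hy) ht.1
    rw [Set.indicator_of_mem hy, ← hH, Set.indicator_of_mem hmem, contractionKernel,
      Set.indicator_of_mem hlt]
    simp only [add_sub_cancel_left, enorm_smul, Real.enorm_of_nonneg ht.1.le]
    have e : ENNReal.ofReal (t ^ 2) * (ENNReal.ofReal ((t ^ 3)⁻¹) * ENNReal.ofReal t) = 1 := by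
      have ht0 := ht.1
      rw [← ENNReal.ofReal_mul (by positivity), ← ENNReal.ofReal_mul (by positivity),
        show t ^ 2 * ((t ^ 3)⁻¹ * t) = 1 by field_simp, ENNReal.ofReal_one]
    calc F (x + t • (y - x)) * ‖y - x‖ₑ
        = (ENNReal.ofReal (t ^ 2) * (ENNReal.ofReal ((t ^ 3)⁻¹) * ENNReal.ofReal t))
          * (F (x + t • (y - x)) * ‖y - x‖ₑ) := by rw [e, one_mul]
      _ ≤ _ := le_of_eq (by ring)
  · simp [Set.indicator_of_notMem hy]

/-- Tonelli twice: fix `t` to contract `K` towards `x`, then fix `z` to integrate out `t`. -/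
theorem setLIntegral_segment_le_potential {K : Set Plane} (hK : IsOpen K) (hKc : Convex ℝ K)
    {F : Plane → ℝ≥0∞} (hF : Measurable F) {x : Plane} (hx : x ∈ closure K) {d : ℝ}
    (hd : ∀ y ∈ K, ‖y - x‖ < d) :
    ∫⁻ y in K, ∫⁻ t in Set.Ioc (0 : ℝ) 1, F (x + t • (y - x)) * ‖y - x‖ₑ
      ≤ ENNReal.ofReal (d ^ 2) * ∫⁻ z in K, F z * ‖x - z‖ₑ⁻¹ := by
  have mm := measurable_contractionKernel x d
  have m1 : Measurable (Function.uncurry fun (y : Plane) (t : ℝ) =>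
      F (x + t • (y - x)) * ‖y - x‖ₑ) := by
    unfold Function.uncurry
    fun_prop
  have m2 : Measurable (Function.uncurry fun (t : ℝ) (z : Plane) =>
      contractionKernel x d t z * (F z * ‖z - x‖ₑ)) :=
    mm.mul ((hF.comp measurable_snd).mul (by fun_prop))
  rw [lintegral_lintegral_swap m1.aemeasurable]
  calc ∫⁻ t in Set.Ioc (0 : ℝ) 1, ∫⁻ y in K, F (x + t • (y - x)) * ‖y - x‖ₑ
      ≤ ∫⁻ t in Set.Ioc (0 : ℝ) 1, ∫⁻ z in K, contractionKernel x d t z * (F z * ‖z - x‖ₑ) :=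
        setLIntegral_mono' measurableSet_Ioc fun t ht =>
          setLIntegral_comp_homothety_le hK hKc hF hx hd ht
    _ = ∫⁻ z in K, ∫⁻ t in Set.Ioc (0 : ℝ) 1, contractionKernel x d t z * (F z * ‖z - x‖ₑ) :=
        lintegral_lintegral_swap m2.aemeasurable
    _ ≤ ∫⁻ z in K, ENNReal.ofReal (d ^ 2) * (F z * ‖x - z‖ₑ⁻¹) := by
        refine setLIntegral_mono' hK.measurableSet fun z hz => ?_
        have hz' : Measurable fun t => contractionKernel x d t z := mm.of_uncurry_right
        exact (lintegral_mul_const (F z * ‖z - x‖ₑ) hz').trans_le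
          (setLIntegral_contractionKernel_mul_le (hd z hz) (F z))
    _ = _ := lintegral_const_mul _ (hF.mul (by fun_prop))

/-- Potential estimate on convex sets, up to the boundary. -/
theorem setLIntegral_enorm_sub_le_potential {K : Set Plane} (hK : IsOpen K) (hKc : Convex ℝ K)
    {φ : Plane → ℝ} (hφ : ContDiff ℝ 1 φ) {x : Plane} (hx : x ∈ closure K) {d : ℝ}
    (hd : ∀ y ∈ K, ‖y - x‖ < d) :
    ∫⁻ y in K, ‖φ x - φ y‖ₑ
      ≤ ENNReal.ofReal (d ^ 2) * ∫⁻ z in K, ‖fderiv ℝ φ z‖ₑ * ‖x - z‖ₑ⁻¹ :=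
  (lintegral_mono fun y => enorm_sub_le_lintegral_fderiv hφ x y).trans
    (setLIntegral_segment_le_potential hK hKc (F := fun z => ‖fderiv ℝ φ z‖ₑ)
      (hφ.continuous_fderiv one_ne_zero).enorm.measurable hx hd)

/-! ### Poincaré and trace inequalities on convex sets -/

theorem enorm_sub_setAverage_le {K : Set Plane} (hK0 : volume K ≠ 0) (hKf : volume K ≠ ⊤)
    {φ : Plane → ℝ} (hφ : IntegrableOn φ K) (x : Plane) :
    ‖φ x - ⨍ y in K, φ y‖ₑ ≤ (volume K)⁻¹ * ∫⁻ y in K, ‖φ x - φ y‖ₑ := by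
  have hc : IntegrableOn (fun _ : Plane => φ x) K := integrableOn_const hKf
  have h1 : φ x - ⨍ y in K, φ y = ⨍ y in K, (φ x - φ y) := by
    rw [setAverage_eq (f := fun y => φ x - φ y), integral_sub hc hφ, smul_sub, ← setAverage_eq,
      ← setAverage_eq, setAverage_const hK0 hKf]
  rw [h1, setAverage_eq, enorm_smul]
  gcongr
  · rw [Real.enorm_of_nonneg (by positivity), Measure.real, ← ENNReal.toReal_inv,
      ENNReal.ofReal_toReal (ENNReal.inv_ne_top.mpr hK0)]
  · exact enorm_integral_le_lintegral_enorm _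

theorem _root_.Continuous.integrableOn_of_isBounded {φ : Plane → ℝ} (hφ : Continuous φ)
    {K : Set Plane} (hK : Bornology.IsBounded K) : IntegrableOn φ K :=
  (hφ.continuousOn.integrableOn_compact hK.isCompact_closure).mono_set subset_closure

/-- A common form of the Sobolev–Poincaré inequality and of the trace inequality on a convex set:
the measure `μ` on the closure of `K` only has to be diffuse enough. -/
theorem exists_eLpNorm_sub_setAverage_le {K : Set Plane} (hK : IsOpen K) (hKc : Convex ℝ K)
    (hKb : Bornology.IsBounded K) (hKn : K.Nonempty) {μ : Measure Plane} [SFinite μ]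
    (hμ : ∀ᵐ x ∂μ, x ∈ closure K) {p α β : ℝ} (hp : 2 ≤ p) (hα : 0 ≤ α) (hβ : 0 ≤ β)
    (hβ2 : β < 2) (hαβ : α / p + β / 2 = 1) {A : ℝ≥0∞} (hA0 : A ≠ ⊤)
    (hA : ∀ z, ∫⁻ x, (‖x - z‖ₑ⁻¹) ^ α ∂μ ≤ A) :
    ∃ C : ℝ≥0∞, C ≠ ⊤ ∧ ∀ φ : Plane → ℝ, ContDiff ℝ 1 φ →
      eLpNorm (fun x => φ x - ⨍ y in K, φ y) (ENNReal.ofReal p) μ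
        ≤ C * eLpNorm (fderiv ℝ φ) 2 (volume.restrict K) := by
  have hp0 : 0 < p := by linarith
  have hK0 : volume K ≠ 0 := (hK.measure_pos _ hKn).ne'
  have hKf : volume K ≠ ⊤ := hKb.measure_lt_top.ne
  obtain ⟨B, hB0, hB⟩ := exists_setLIntegral_inv_enorm_sub_rpow_le (volume : Measure Plane)
    (by simp) hβ (by simpa using hβ2) hK.measurableSet hKf
  -- The extra 1 makes the distance bound strict.
  set d := Metric.diam (closure K) + 1 with hd
  have hdx : ∀ x ∈ closure K, ∀ y ∈ K, ‖y - x‖ < d := by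
    intro x hx y hy
    rw [← dist_eq_norm]
    exact (Metric.dist_le_diam_of_mem hKb.closure (subset_closure hy) hx).trans_lt (lt_add_one _)
  set c := (volume K)⁻¹ * ENNReal.ofReal (d ^ 2) with hc
  have hcf : c ≠ ⊤ := ENNReal.mul_ne_top (ENNReal.inv_ne_top.mpr hK0) ENNReal.ofReal_ne_top
  refine ⟨c * (A * B ^ (p / 2)) ^ (1 / p), ENNReal.mul_ne_top hcf
    (ENNReal.rpow_ne_top_of_nonneg (by positivity)
      (ENNReal.mul_ne_top hA0 (ENNReal.rpow_ne_top_of_nonneg (by positivity) hB0))), fun φ hφ => ?_⟩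
  set g : Plane → ℝ≥0∞ := fun z => ‖fderiv ℝ φ z‖ₑ with hg
  have hgm : Measurable g := (hφ.continuous_fderiv one_ne_zero).enorm.measurable
  have hpt : ∀ᵐ x ∂μ, ‖φ x - ⨍ y in K, φ y‖ₑ ≤ c * ∫⁻ z in K, g z * ‖x - z‖ₑ⁻¹ := by
    filter_upwards [hμ] with x hx
    refine (enorm_sub_setAverage_le hK0 hKf
      (hφ.continuous.integrableOn_of_isBounded hKb) x).trans ?_
    rw [hc, mul_assoc]
    gcongr
    exact setLIntegral_enorm_sub_le_potential hK hKc hφ hx (hdx x hx)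
  have hk : Measurable (Function.uncurry fun x z : Plane => ‖x - z‖ₑ⁻¹) := by
    unfold Function.uncurry
    fun_prop
  have hker := lintegral_rpow_lintegral_mul_le (μ := μ) (ν := volume.restrict K) hgm hk hp hα hβ
    hαβ hA (fun x => by
      simp only [enorm_sub_rev x]
      exact hB x)
  have hmI : Measurable fun x => ∫⁻ z in K, g z * ‖x - z‖ₑ⁻¹ :=
    Measurable.lintegral_prod_right' (f := fun q : Plane × Plane => g q.2 * ‖q.1 - q.2‖ₑ⁻¹)
      ((hgm.comp measurable_snd).mul hk)
  rw [eLpNorm_eq_lintegral_rpow_enorm_toReal (by simpa using hp0) ENNReal.ofReal_ne_top,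
    eLpNorm_eq_lintegral_rpow_enorm_toReal two_ne_zero ENNReal.ofNat_ne_top,
    ENNReal.toReal_ofReal hp0.le, ENNReal.toReal_ofNat]
  calc (∫⁻ x, ‖φ x - ⨍ y in K, φ y‖ₑ ^ p ∂μ) ^ (1 / p)
      ≤ (∫⁻ x, (c * ∫⁻ z in K, g z * ‖x - z‖ₑ⁻¹) ^ p ∂μ) ^ (1 / p) := by
        refine ENNReal.rpow_le_rpow (lintegral_mono_ae ?_) (by positivity)
        filter_upwards [hpt] with x hx
        gcongr
    _ = (c ^ p * ∫⁻ x, (∫⁻ z in K, g z * ‖x - z‖ₑ⁻¹) ^ p ∂μ) ^ (1 / p) := by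
        simp only [ENNReal.mul_rpow_of_nonneg _ _ hp0.le]
        rw [lintegral_const_mul _ (hmI.pow_const _)]
    _ ≤ (c ^ p * (A * B ^ (p / 2) * (∫⁻ z in K, g z ^ (2 : ℝ)) ^ (p / 2))) ^ (1 / p) := by
        gcongr
    _ = c * (A * B ^ (p / 2)) ^ (1 / p) * (∫⁻ z in K, g z ^ (2 : ℝ)) ^ (1 / 2 : ℝ) := by
        rw [ENNReal.mul_rpow_of_nonneg _ _ (by positivity),
          ENNReal.mul_rpow_of_nonneg (A * B ^ (p / 2)) _ (by positivity), ← ENNReal.rpow_mul,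
          ← ENNReal.rpow_mul (∫⁻ z in K, g z ^ (2 : ℝ)), mul_one_div_cancel hp0.ne',
          ENNReal.rpow_one, ← mul_assoc, show p / 2 * (1 / p) = 1 / 2 by field_simp]

/-- Sobolev–Poincaré inequality on a bounded convex set. -/
theorem exists_eLpNorm_restrict_sub_setAverage_le {K : Set Plane} (hK : IsOpen K)
    (hKc : Convex ℝ K) (hKb : Bornology.IsBounded K) (hKn : K.Nonempty) {p : ℝ} (hp : 2 ≤ p) :
    ∃ C : ℝ≥0∞, C ≠ ⊤ ∧ ∀ φ : Plane → ℝ, ContDiff ℝ 1 φ →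
      eLpNorm (fun x => φ x - ⨍ y in K, φ y) (ENNReal.ofReal p) (volume.restrict K)
        ≤ C * eLpNorm (fderiv ℝ φ) 2 (volume.restrict K) := by
  have hp0 : 0 < p := by linarith
  -- Taking `α = β` in `α/p + β/2 = 1` forces `2p/(p + 2)`, which is below the dimension 2 for every
  -- finite `p`.
  have hr0 : 0 ≤ 2 * p / (p + 2) := by positivity
  have hr2 : 2 * p / (p + 2) < 2 := by
    rw [div_lt_iff₀ (by positivity)]
    linarith
  obtain ⟨A, hA0, hA⟩ := exists_setLIntegral_inv_enorm_sub_rpow_le (volume : Measure Plane)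
    (by simp) hr0 (by simpa using hr2) hK.measurableSet hKb.measure_lt_top.ne
  refine exists_eLpNorm_sub_setAverage_le hK hKc hKb hKn ?_ hp hr0 hr0 hr2 ?_ hA0 hA
  · filter_upwards [ae_restrict_mem hK.measurableSet] with x hx using subset_closure hx
  · field_simp
    ring

/-- Arc length on a bounded part of a line is diffuse enough for the trace inequality. -/
theorem exists_setLIntegral_hausdorffMeasure_le (a e : Plane) (he : ‖e‖ = 1) (L : ℝ) {α : ℝ}
    (hα : 0 ≤ α) (hα1 : α < 1) :
    ∃ A : ℝ≥0∞, A ≠ ⊤ ∧ ∀ z, ∫⁻ x in (fun s : ℝ => a + s • e) '' Set.Icc 0 L,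
      (‖x - z‖ₑ⁻¹) ^ α ∂(μH[1] : Measure Plane) ≤ A := by
  obtain ⟨A, hA0, hA⟩ := exists_setLIntegral_inv_enorm_sub_rpow_le (volume : Measure ℝ)
    (by simp) hα (by simpa using hα1) (measurableSet_Icc (a := 0) (b := L)) (by simp)
  have hiso : Isometry fun s : ℝ => a + s • e := by
    refine Isometry.of_dist_eq fun s t => ?_
    rw [dist_add_left, dist_eq_norm, ← sub_smul, norm_smul, he, mul_one, dist_eq_norm]
  refine ⟨A, hA0, fun z => ?_⟩
  have hms : MeasurableSet ((fun s : ℝ => a + s • e) '' Set.Icc 0 L) :=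
    (isCompact_Icc.image hiso.continuous).measurableSet
  have hmap : (μH[1] : Measure Plane).restrict ((fun s : ℝ => a + s • e) '' Set.Icc 0 L)
      = (volume.restrict (Set.Icc 0 L)).map (fun s : ℝ => a + s • e) := by
    have h := hiso.map_hausdorffMeasure (d := 1) (Or.inl zero_le_one)
    rw [hausdorffMeasure_real] at h
    have h2 := congrArg (fun ν => Measure.restrict ν ((fun s : ℝ => a + s • e) '' Set.Icc 0 L)) h
    simp only [Measure.restrict_restrict hms] at h2
    rw [Set.inter_eq_left.mpr (Set.image_subset_range _ _),
      Measure.restrict_map hiso.continuous.measurable hms,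
      Set.preimage_image_eq _ hiso.injective] at h2
    exact h2.symm
  rw [hmap, lintegral_map (by fun_prop) hiso.continuous.measurable]
  -- Orthogonal projection of `z` to the line does not increase its distance to points of the line,
  -- which reduces the claim to the kernel bound on `ℝ`.
  refine le_trans ?_ (hA (inner ℝ e (z - a)))
  refine lintegral_mono fun s => ?_
  refine ENNReal.rpow_le_rpow (ENNReal.inv_le_inv.mpr ?_) hα
  rw [← ofReal_norm, ← ofReal_norm]
  apply ENNReal.ofReal_le_ofReal
  have h1 : s - inner ℝ e (z - a) = inner ℝ e (a + s • e - z) := by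
    have : a + s • e - z = s • e - (z - a) := by abel
    rw [this, inner_sub_right (𝕜 := ℝ) e (s • e), inner_smul_right, real_inner_self_eq_norm_sq, he]
    ring
  rw [h1]
  simpa [he] using norm_inner_le_norm (𝕜 := ℝ) e (a + s • e - z)

/-! ### Comparing averages over convex pieces -/

/-- `K` is a nonempty bounded open convex subset of `Ω`. -/
structure IsConvexSubdomain (Ω K : Set Plane) : Prop where
  isOpen : IsOpen K
  convex : Convex ℝ K
  isBounded : Bornology.IsBounded K
  nonempty : K.Nonempty
  subset : K ⊆ Ω

theorem isConvexSubdomain_ball {Ω : Set Plane} {x : Plane} {r : ℝ} (hr : 0 < r)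
    (h : Metric.ball x r ⊆ Ω) : IsConvexSubdomain Ω (Metric.ball x r) :=
  ⟨Metric.isOpen_ball, convex_ball x r, Metric.isBounded_ball, ⟨x, Metric.mem_ball_self hr⟩, h⟩

/-- The averages of functions over `K` and `L` differ by at most a multiple of the `L²(Ω)` norm of
the derivative. -/
def AverageComparable (Ω K L : Set Plane) : Prop :=
  ∃ C : ℝ≥0∞, C ≠ ⊤ ∧ ∀ φ : Plane → ℝ, ContDiff ℝ 1 φ →
    ‖(⨍ y in K, φ y) - ⨍ y in L, φ y‖ₑ ≤ C * eLpNorm (fderiv ℝ φ) 2 (volume.restrict Ω)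

theorem AverageComparable.trans {Ω K L M : Set Plane} (h : AverageComparable Ω K L)
    (h' : AverageComparable Ω L M) : AverageComparable Ω K M := by
  obtain ⟨C, hC, h⟩ := h
  obtain ⟨C', hC', h'⟩ := h'
  refine ⟨C + C', ENNReal.add_ne_top.mpr ⟨hC, hC'⟩, fun φ hφ => ?_⟩
  rw [add_mul, ← sub_add_sub_cancel _ (⨍ y in L, φ y)]
  exact (enorm_add_le _ _).trans (add_le_add (h φ hφ) (h' φ hφ))

theorem enorm_sub_le_eLpNorm_sub_const {X : Type*} [MeasurableSpace X] {μ : Measure X}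
    (hμ0 : μ Set.univ ≠ 0) (hμ1 : μ Set.univ ≠ ⊤) {φ : X → ℝ} (hφ : AEStronglyMeasurable φ μ)
    (a b : ℝ) :
    ‖a - b‖ₑ ≤ ((μ Set.univ) ^ (1 / 2 : ℝ))⁻¹ *
      (eLpNorm (fun x => φ x - b) 2 μ + eLpNorm (fun x => φ x - a) 2 μ) := by
  have h1 := eLpNorm_sub_le (p := 2) (hφ.sub (aestronglyMeasurable_const (b := b)))
    (hφ.sub (aestronglyMeasurable_const (b := a))) (by norm_num)
  have h2 : (φ - fun _ => b) - (φ - fun _ => a) = fun _ => a - b := by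
    ext x
    simp
  rw [h2, eLpNorm_const' _ two_ne_zero ENNReal.ofNat_ne_top, ENNReal.toReal_ofNat] at h1
  rw [mul_comm, ← div_eq_mul_inv, ENNReal.le_div_iff_mul_le]
  · exact h1
  · left
    simpa using hμ0
  · left
    exact ENNReal.rpow_ne_top_of_nonneg (by norm_num) hμ1

/-- On the overlap, which has positive measure, `φ` is `L²`-close to both averages by Poincaré, so
the two constants are close. -/
theorem averageComparable_of_inter_nonempty {Ω K L : Set Plane} (hK : IsConvexSubdomain Ω K)
    (hL : IsConvexSubdomain Ω L) (h : (K ∩ L).Nonempty) : AverageComparable Ω K L := by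
  obtain ⟨C, hC, hCφ⟩ := exists_eLpNorm_restrict_sub_setAverage_le hK.isOpen hK.convex
    hK.isBounded hK.nonempty le_rfl
  obtain ⟨C', hC', hCφ'⟩ := exists_eLpNorm_restrict_sub_setAverage_le hL.isOpen hL.convex
    hL.isBounded hL.nonempty le_rfl
  have hV0 : volume (K ∩ L) ≠ 0 := ((hK.isOpen.inter hL.isOpen).measure_pos _ h).ne'
  have hV1 : volume (K ∩ L) ≠ ⊤ := (hK.isBounded.subset Set.inter_subset_left).measure_lt_top.ne
  rw [← Measure.restrict_apply_univ] at hV0 hV1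
  refine ⟨((volume.restrict (K ∩ L) Set.univ) ^ (1 / 2 : ℝ))⁻¹ * (C' + C), ENNReal.mul_ne_top
    (ENNReal.inv_ne_top.mpr (by simpa using hV0)) (ENNReal.add_ne_top.mpr ⟨hC', hC⟩),
    fun φ hφ => ?_⟩
  refine (enorm_sub_le_eLpNorm_sub_const hV0 hV1 hφ.continuous.aestronglyMeasurable _ _).trans ?_
  rw [mul_assoc, add_mul]
  simp only [ENNReal.ofReal_ofNat] at hCφ hCφ'
  gcongr
  · refine (eLpNorm_mono_measure _ (Measure.restrict_mono Set.inter_subset_right le_rfl)).trans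
      ((hCφ' φ hφ).trans ?_)
    gcongr
    exact hL.subset
  · refine (eLpNorm_mono_measure _ (Measure.restrict_mono Set.inter_subset_left le_rfl)).trans
      ((hCφ φ hφ).trans ?_)
    gcongr
    exact hK.subset

/-- A chain of overlapping balls, phrased through connectedness: the pieces comparable with `K` and
those that are not would form two open sets covering `Ω`, and at a common point comparability would
pass from one kind to the other. -/
theorem averageComparable_of_isPreconnected {Ω : Set Plane} (hΩ : IsOpen Ω)
    (hΩc : IsPreconnected Ω) {K L : Set Plane} (hK : IsConvexSubdomain Ω K)
    (hL : IsConvexSubdomain Ω L) : AverageComparable Ω K L := by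
  by_contra hKL
  set S := ⋃₀ {M | IsConvexSubdomain Ω M ∧ AverageComparable Ω K M} with hS
  set T := ⋃₀ {M | IsConvexSubdomain Ω M ∧ ¬ AverageComparable Ω K M} with hT
  have hSo : IsOpen S := isOpen_sUnion fun M hM => hM.1.isOpen
  have hTo : IsOpen T := isOpen_sUnion fun M hM => hM.1.isOpen
  have hcover : Ω ⊆ S ∪ T := by
    intro x hx
    obtain ⟨r, hr, hball⟩ := Metric.isOpen_iff.mp hΩ x hx
    by_cases h : AverageComparable Ω K (Metric.ball x r)
    · exact Or.inl ⟨_, ⟨isConvexSubdomain_ball hr hball, h⟩, Metric.mem_ball_self hr⟩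
    · exact Or.inr ⟨_, ⟨isConvexSubdomain_ball hr hball, h⟩, Metric.mem_ball_self hr⟩
  obtain ⟨x, hx⟩ := hK.nonempty
  obtain ⟨y, hy⟩ := hL.nonempty
  obtain ⟨z, -, ⟨M, hM, hzM⟩, ⟨N, hN, hzN⟩⟩ := hΩc S T hSo hTo hcover
    ⟨x, hK.subset hx, K, ⟨hK, averageComparable_of_inter_nonempty hK hK ⟨x, hx, hx⟩⟩, hx⟩
    ⟨y, hL.subset hy, L, ⟨hL, hKL⟩, hy⟩
  exact hN.2 (hM.2.trans (averageComparable_of_inter_nonempty hM.1 hN.1 ⟨z, hzM, hzN⟩))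

/-! ### Decomposition into convex cells -/

theorem volume_line_eq_zero {n : Plane} (hn : n ≠ 0) (a : Plane) :
    volume {x : Plane | inner ℝ n (x - a) = 0} = 0 := by
  have h : {x : Plane | inner ℝ n (x - a) = 0}
      = (AffineSubspace.mk' a (Submodule.span ℝ {n})ᗮ : Set Plane) := by
    ext x
    rw [SetLike.mem_coe, AffineSubspace.mem_mk', Submodule.mem_orthogonal_singleton_iff_inner_right]
    rfl
  rw [h]
  refine Measure.addHaar_affineSubspace _ _ fun htop => hn ?_
  have h1 : a + n ∈ AffineSubspace.mk' a (Submodule.span ℝ {n})ᗮ := by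
    rw [htop]
    trivial
  rw [AffineSubspace.mem_mk', Submodule.mem_orthogonal_singleton_iff_inner_right] at h1
  simpa using h1

/-- Relative to `K`, the set `Ω` is clopen and nonempty. -/
theorem subset_of_inter_nonempty_of_disjoint_frontier {Ω K : Set Plane} (hΩ : IsOpen Ω)
    (hK : IsPreconnected K) (h : (K ∩ Ω).Nonempty) (hd : Disjoint (frontier Ω) K) : K ⊆ Ω := by
  have := isPreconnected_iff_preconnectedSpace.mp hK
  obtain ⟨x, hxK, hxΩ⟩ := h
  have h1 := (isClopen_preimage_val hΩ hd).eq_univ ⟨⟨x, hxK⟩, hxΩ⟩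
  intro y hy
  have : (⟨y, hy⟩ : K) ∈ (Subtype.val ⁻¹' Ω : Set K) := by
    rw [h1]
    trivial
  exact this

/-- A bounded open set whose frontier lies on finitely many lines is, up to a null set, a finite
union of convex open sets. -/
theorem exists_finite_convexSubdomain_cover {Ω : Set Plane} (hΩ : IsOpen Ω)
    (hΩb : Bornology.IsBounded Ω) {ι : Type*} [Finite ι] (n a : ι → Plane) (hn : ∀ i, n i ≠ 0)
    (hfr : ∀ x ∈ frontier Ω, ∃ i, inner ℝ (n i) (x - a i) = 0) :
    ∃ 𝒦 : Set (Set Plane), 𝒦.Finite ∧ (∀ K ∈ 𝒦, IsConvexSubdomain Ω K) ∧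
      volume (Ω \ ⋃₀ 𝒦) = 0 := by
  -- A sign vector chooses one open side of each line. The cells avoid all the lines, hence the
  -- frontier of `Ω`, so each lies in `Ω` as soon as it meets it.
  set cell : (ι → ℤˣ) → Set Plane := fun ε =>
    ⋂ i, {x | 0 < ((ε i : ℤ) : ℝ) * inner ℝ (n i) (x - a i)} with hcell
  have hopen : ∀ ε, IsOpen (cell ε) := fun ε =>
    isOpen_iInter_of_finite fun i => isOpen_lt continuous_const (by fun_prop)
  have hconv : ∀ ε, Convex ℝ (cell ε) := by
    intro ε
    refine convex_iInter fun i => ?_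
    intro x hx y hy s t hs ht hst
    simp only [Set.mem_ofPred_eq] at hx hy ⊢
    have e : s • x + t • y - a i = s • (x - a i) + t • (y - a i) := by
      rw [smul_sub, smul_sub]
      nth_rewrite 1 [← one_smul ℝ (a i), ← hst, add_smul]
      abel
    rw [e, inner_add_right, inner_smul_right, inner_smul_right]
    rcases hs.eq_or_lt with rfl | hs
    · have : t = 1 := by linarith
      subst this
      simpa using hy
    · have := mul_pos hs hx
      have := mul_nonneg ht hy.le
      nlinarith
  have : Finite (ι → ℤˣ) := Pi.finite
  refine ⟨{K | K ∈ Set.range cell ∧ K ⊆ Ω ∧ K.Nonempty},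
    (Set.finite_range cell).subset fun K hK => hK.1, ?_, ?_⟩
  · rintro K ⟨⟨ε, rfl⟩, hsub, hne⟩
    exact ⟨hopen ε, hconv ε, hΩb.subset hsub, hne, hsub⟩
  · refine measure_mono_null (t := ⋃ i, {x : Plane | inner ℝ (n i) (x - a i) = 0}) ?_
      (measure_iUnion_null fun i => volume_line_eq_zero (hn i) (a i))
    rintro x ⟨hxΩ, hx⟩
    by_contra hline
    simp only [Set.mem_iUnion, Set.mem_ofPred_eq, not_exists] at hline
    apply hx
    set ε : ι → ℤˣ := fun i => if 0 < inner ℝ (n i) (x - a i) then 1 else -1 with hε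
    have hxε : x ∈ cell ε := by
      refine Set.mem_iInter.mpr fun i => ?_
      rcases lt_or_gt_of_ne (hline i) with h | h
      · simp [hε, h.not_gt, h]
      · simp [hε, h]
    refine ⟨cell ε, ⟨⟨ε, rfl⟩, ?_, ⟨x, hxε⟩⟩, hxε⟩
    refine subset_of_inter_nonempty_of_disjoint_frontier hΩ (hconv ε).isPreconnected
      ⟨x, hxε, hxΩ⟩ ?_
    rw [Set.disjoint_left]
    intro y hy hyε
    obtain ⟨i, hi⟩ := hfr y hy
    have := Set.mem_iInter.mp hyε i
    simp [hi] at this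

/-- The part of `Ω` outside the closure of the union is open and null, hence empty. This lets
boundary segments be covered by closures of cells. -/
theorem closure_subset_biUnion_closure {Ω : Set Plane} (hΩ : IsOpen Ω) {𝒦 : Set (Set Plane)}
    (hf : 𝒦.Finite) (h0 : volume (Ω \ ⋃₀ 𝒦) = 0) : closure Ω ⊆ ⋃ K ∈ 𝒦, closure K := by
  rw [← hf.closure_sUnion]
  refine closure_minimal ?_ isClosed_closure
  by_contra hsub
  obtain ⟨x, hx, hx'⟩ := Set.not_subset.mp hsub
  refine ((hΩ.inter isClosed_closure.isOpen_compl).measure_pos volume ⟨x, hx, hx'⟩).ne' ?_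
  exact measure_mono_null (fun y (hy : y ∈ Ω ∩ (closure (⋃₀ 𝒦))ᶜ) =>
    (⟨hy.1, fun hy' => hy.2 (subset_closure hy')⟩ : y ∈ Ω \ ⋃₀ 𝒦)) h0

theorem eLpNorm_restrict_le_sum {Ω : Set Plane} {𝒦 : Finset (Set Plane)}
    (hm : ∀ K ∈ 𝒦, MeasurableSet K) (h0 : volume (Ω \ ⋃₀ (𝒦 : Set (Set Plane))) = 0)
    {φ : Plane → ℝ} (hφ : Continuous φ) {p : ℝ≥0∞} (hp : 1 ≤ p) :
    eLpNorm φ p (volume.restrict Ω) ≤ ∑ K ∈ 𝒦, eLpNorm φ p (volume.restrict K) := by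
  have hU : MeasurableSet (⋃₀ (𝒦 : Set (Set Plane))) :=
    MeasurableSet.sUnion 𝒦.countable_toSet hm
  calc eLpNorm φ p (volume.restrict Ω)
      ≤ eLpNorm φ p (volume.restrict (⋃₀ (𝒦 : Set (Set Plane)))) := by
        refine eLpNorm_mono_measure _ (Measure.restrict_mono_ae ?_)
        rw [ae_le_set]
        exact h0
    _ = eLpNorm ((⋃₀ (𝒦 : Set (Set Plane))).indicator φ) p volume :=
        (eLpNorm_indicator_eq_eLpNorm_restrict hU).symm
    _ ≤ eLpNorm (∑ K ∈ 𝒦, K.indicator fun x => ‖φ x‖) p volume := by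
        refine eLpNorm_mono fun x => ?_
        rw [Finset.sum_apply, Real.norm_of_nonneg
          (Finset.sum_nonneg fun K _ => Set.indicator_nonneg (fun y _ => norm_nonneg _) x)]
        by_cases hx : x ∈ ⋃₀ (𝒦 : Set (Set Plane))
        · obtain ⟨K, hK, hxK⟩ := hx
          rw [Set.indicator_of_mem (show x ∈ ⋃₀ (𝒦 : Set (Set Plane)) from ⟨K, hK, hxK⟩)]
          refine le_trans ?_ (Finset.single_le_sum (f := fun K => K.indicator (fun x => ‖φ x‖) x)
            (fun K _ => Set.indicator_nonneg (fun y _ => norm_nonneg _) x) hK)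
          rw [Set.indicator_of_mem hxK]
        · rw [Set.indicator_of_notMem hx, norm_zero]
          exact Finset.sum_nonneg fun K _ => Set.indicator_nonneg (fun y _ => norm_nonneg _) x
    _ ≤ ∑ K ∈ 𝒦, eLpNorm (K.indicator fun x => ‖φ x‖) p volume :=
        eLpNorm_sum_le (fun K hK => hφ.norm.aestronglyMeasurable.indicator (hm K hK)) hp
    _ = _ := Finset.sum_congr rfl fun K hK => by
        rw [eLpNorm_indicator_eq_eLpNorm_restrict (hm K hK), eLpNorm_norm]

/-! ### Sobolev inequality with a boundary term -/

/-- By pigeonhole, some cell closure meets the segment in positive length. The trace inequality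
there, with exponents `1/2` and `3/2`, compares `φ` with the cell average, while the boundary norm
compares `φ` with 0. -/
theorem exists_enorm_setAverage_le {Ω : Set Plane} {𝒦 : Finset (Set Plane)}
    (h𝒦 : ∀ K ∈ 𝒦, IsConvexSubdomain Ω K) {a e : Plane} (he : ‖e‖ = 1) {L : ℝ} (hL : 0 < L)
    (hcov : (fun s : ℝ => a + s • e) '' Set.Icc 0 L ⊆ ⋃ K ∈ 𝒦, closure K) :
    ∃ K ∈ 𝒦, ∃ C : ℝ≥0∞, C ≠ ⊤ ∧ ∀ φ : Plane → ℝ, ContDiff ℝ 1 φ →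
      ‖⨍ y in K, φ y‖ₑ ≤ C * (eLpNorm (fderiv ℝ φ) 2 (volume.restrict Ω) + eLpNorm φ 2
        ((μH[1] : Measure Plane).restrict ((fun s : ℝ => a + s • e) '' Set.Icc 0 L))) := by
  set E := (fun s : ℝ => a + s • e) '' Set.Icc 0 L with hE
  have hiso : Isometry fun s : ℝ => a + s • e := by
    refine Isometry.of_dist_eq fun s t => ?_
    rw [dist_add_left, dist_eq_norm, ← sub_smul, norm_smul, he, mul_one, dist_eq_norm]
  have hEμ : (μH[1] : Measure Plane) E = ENNReal.ofReal L := by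
    rw [hE, hiso.hausdorffMeasure_image (Or.inl zero_le_one), hausdorffMeasure_real,
      Real.volume_Icc, sub_zero]
  obtain ⟨K, hK, hKE⟩ : ∃ K ∈ 𝒦, (μH[1] : Measure Plane) (E ∩ closure K) ≠ 0 := by
    by_contra! hcon
    have h0 : (μH[1] : Measure Plane) (⋃ K ∈ 𝒦, E ∩ closure K) = 0 :=
      (measure_biUnion_null_iff 𝒦.countable_toSet).mpr hcon
    have h1 : E ⊆ ⋃ K ∈ 𝒦, E ∩ closure K := by
      rw [← Set.inter_iUnion₂]
      exact Set.subset_inter subset_rfl hcov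
    have := measure_mono_null h1 h0
    rw [hEμ] at this
    simp only [ENNReal.ofReal_eq_zero] at this
    linarith
  have hKs := h𝒦 K hK
  have hEfin : (μH[1] : Measure Plane) (E ∩ closure K) ≠ ⊤ :=
    ((measure_mono Set.inter_subset_left).trans_lt (hEμ ▸ ENNReal.ofReal_lt_top)).ne
  set μ := (μH[1] : Measure Plane).restrict (E ∩ closure K) with hμ
  have hfin : IsFiniteMeasure μ := ⟨by rw [Measure.restrict_apply_univ]; exact hEfin.lt_top⟩
  have hEm : MeasurableSet (E ∩ closure K) :=
    (isCompact_Icc.image hiso.continuous).measurableSet.inter isClosed_closure.measurableSet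
  obtain ⟨A, hA0, hA⟩ := exists_setLIntegral_hausdorffMeasure_le a e he L (α := 1 / 2)
    (by norm_num) (by norm_num)
  obtain ⟨C, hC, hCφ⟩ := exists_eLpNorm_sub_setAverage_le hKs.isOpen hKs.convex hKs.isBounded
    hKs.nonempty (μ := μ) (p := 2) (α := 1 / 2) (β := 3 / 2)
    ((ae_restrict_mem hEm).mono fun x hx => hx.2) le_rfl (by norm_num) (by norm_num) (by norm_num)
    (by norm_num) hA0 (fun z => (lintegral_mono_set Set.inter_subset_left).trans (hA z))
  simp only [ENNReal.ofReal_ofNat] at hCφ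
  rw [← Measure.restrict_apply_univ, ← hμ] at hKE hEfin
  refine ⟨K, hK, (μ Set.univ ^ (1 / 2 : ℝ))⁻¹ * (C + 1), ENNReal.mul_ne_top
    (ENNReal.inv_ne_top.mpr fun h => hKE ((ENNReal.rpow_eq_zero_iff_of_pos (by norm_num)).mp h)) (ENNReal.add_ne_top.mpr ⟨hC, ENNReal.one_ne_top⟩),
    fun φ hφ => ?_⟩
  have h1 := enorm_sub_le_eLpNorm_sub_const hKE hEfin
    (hφ.continuous.aestronglyMeasurable (μ := μ)) 0 (⨍ y in K, φ y)
  rw [zero_sub, enorm_neg] at h1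
  simp only [sub_zero] at h1
  refine h1.trans ?_
  rw [mul_assoc]
  refine mul_le_mul' le_rfl ?_
  set N := eLpNorm (fderiv ℝ φ) 2 (volume.restrict Ω)
  set M := eLpNorm φ 2 ((μH[1] : Measure Plane).restrict E)
  calc _ ≤ C * N + M := by
        gcongr
        · refine (hCφ φ hφ).trans ?_
          gcongr
          exact eLpNorm_mono_measure _ (Measure.restrict_mono hKs.subset le_rfl)
        · exact eLpNorm_mono_measure _ (Measure.restrict_mono Set.inter_subset_left le_rfl)
    _ ≤ C * N + M + (C * M + N) := le_self_add
    _ = (C + 1) * (N + M) := by ring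

/-- Sobolev inequality for smooth functions, with a boundary term on a segment. -/
theorem exists_eLpNorm_le_fderiv_add_segment {Ω : Set Plane} (hΩ : IsOpen Ω)
    (hΩb : Bornology.IsBounded Ω) (hΩc : IsPreconnected Ω) {ι : Type*} [Finite ι]
    (n c : ι → Plane) (hn : ∀ i, n i ≠ 0)
    (hfr : ∀ x ∈ frontier Ω, ∃ i, inner ℝ (n i) (x - c i) = 0) {a e : Plane} (he : ‖e‖ = 1)
    {L : ℝ} (hL : 0 < L) (hE : (fun s : ℝ => a + s • e) '' Set.Icc 0 L ⊆ closure Ω)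
    {p : ℝ} (hp : 2 ≤ p) :
    ∃ C : ℝ≥0∞, C ≠ ⊤ ∧ ∀ φ : Plane → ℝ, ContDiff ℝ 1 φ →
      eLpNorm φ (ENNReal.ofReal p) (volume.restrict Ω)
        ≤ C * (eLpNorm (fderiv ℝ φ) 2 (volume.restrict Ω) + eLpNorm φ 2
          ((μH[1] : Measure Plane).restrict ((fun s : ℝ => a + s • e) '' Set.Icc 0 L))) := by
  have hp1 : 1 ≤ ENNReal.ofReal p := by
    rw [ENNReal.one_le_ofReal]
    linarith
  obtain ⟨𝒦', hfin, h𝒦', h0⟩ := exists_finite_convexSubdomain_cover hΩ hΩb n c hn hfr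
  obtain ⟨𝒦, rfl⟩ := hfin.exists_finset_coe
  obtain ⟨K₀, hK₀, C₀, hC₀, hφ₀⟩ := exists_enorm_setAverage_le h𝒦' he hL
    (hE.trans (closure_subset_biUnion_closure hΩ hfin h0))
  have hloc : ∀ K ∈ 𝒦, ∃ C : ℝ≥0∞, C ≠ ⊤ ∧ ∀ φ : Plane → ℝ, ContDiff ℝ 1 φ →
      eLpNorm φ (ENNReal.ofReal p) (volume.restrict K)
        ≤ C * (eLpNorm (fderiv ℝ φ) 2 (volume.restrict Ω) + eLpNorm φ 2
          ((μH[1] : Measure Plane).restrict ((fun s : ℝ => a + s • e) '' Set.Icc 0 L))) := by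
    intro K hK
    have hKs := h𝒦' K hK
    obtain ⟨C₁, hC₁, h₁⟩ := exists_eLpNorm_restrict_sub_setAverage_le hKs.isOpen hKs.convex
      hKs.isBounded hKs.nonempty hp
    obtain ⟨C₂, hC₂, h₂⟩ := averageComparable_of_isPreconnected hΩ hΩc hKs (h𝒦' K₀ hK₀)
    set V := volume K ^ (1 / p) with hV
    have hVf : V ≠ ⊤ := ENNReal.rpow_ne_top_of_nonneg (by positivity)
      hKs.isBounded.measure_lt_top.ne
    refine ⟨C₁ + (C₂ + C₀) * V, ENNReal.add_ne_top.mpr ⟨hC₁, ENNReal.mul_ne_top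
      (ENNReal.add_ne_top.mpr ⟨hC₂, hC₀⟩) hVf⟩, fun φ hφ => ?_⟩
    set N := eLpNorm (fderiv ℝ φ) 2 (volume.restrict Ω)
    set M := eLpNorm φ 2
      ((μH[1] : Measure Plane).restrict ((fun s : ℝ => a + s • e) '' Set.Icc 0 L))
    -- Only the average over `K₀` is controlled by the boundary; it is carried over to `K` by
    -- comparability.
    have hav : ‖⨍ y in K, φ y‖ₑ ≤ (C₂ + C₀) * (N + M) := by
      calc ‖⨍ y in K, φ y‖ₑ
          = ‖((⨍ y in K, φ y) - ⨍ y in K₀, φ y) + ⨍ y in K₀, φ y‖ₑ := by rw [sub_add_cancel]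
        _ ≤ C₂ * N + C₀ * (N + M) :=
            (enorm_add_le _ _).trans (add_le_add (h₂ φ hφ) (hφ₀ φ hφ))
        _ ≤ C₂ * (N + M) + C₀ * (N + M) := by
            gcongr
            exact le_self_add
        _ = _ := by ring
    have hsum : φ = (fun x => φ x - ⨍ y in K, φ y) + fun _ => ⨍ y in K, φ y := by
      ext x
      simp
    calc eLpNorm φ (ENNReal.ofReal p) (volume.restrict K)
        ≤ eLpNorm (fun x => φ x - ⨍ y in K, φ y) (ENNReal.ofReal p) (volume.restrict K)
          + eLpNorm (fun _ => ⨍ y in K, φ y) (ENNReal.ofReal p) (volume.restrict K) := by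
          conv_lhs => rw [hsum]
          exact eLpNorm_add_le (hφ.continuous.sub continuous_const).aestronglyMeasurable
            aestronglyMeasurable_const hp1
      _ ≤ C₁ * (N + M) + (C₂ + C₀) * (N + M) * V := by
          gcongr
          · refine (h₁ φ hφ).trans ?_
            gcongr
            exact (eLpNorm_mono_measure _ (Measure.restrict_mono hKs.subset le_rfl)).trans
              le_self_add
          · rw [eLpNorm_const' _ (by simp; linarith) ENNReal.ofReal_ne_top,
              Measure.restrict_apply_univ, ENNReal.toReal_ofReal (by linarith)]
            gcongr
      _ = _ := by ring
  choose! C hC hCφ using hloc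
  refine ⟨∑ K ∈ 𝒦, C K, (ENNReal.sum_ne_top.mpr hC), fun φ hφ => ?_⟩
  refine (eLpNorm_restrict_le_sum (fun K hK => (h𝒦' K hK).isOpen.measurableSet) h0
    hφ.continuous hp1).trans ?_
  rw [Finset.sum_mul]
  exact Finset.sum_le_sum fun K hK => hCφ K hK φ hφ

theorem exists_ne_zero_inner_eq_zero (v : Plane) : ∃ n : Plane, n ≠ 0 ∧ inner ℝ n v = 0 := by
  by_cases hv : v = 0
  · exact ⟨EuclideanSpace.single 0 1, by simp, by simp [hv]⟩
  · refine ⟨!₂[-(v 1), v 0], fun h => hv ?_, ?_⟩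
    · ext i
      have h0 := congrArg (fun w : Plane => w 0) h
      have h1 := congrArg (fun w : Plane => w 1) h
      simp only [Matrix.cons_val_zero, Matrix.cons_val_one, PiLp.zero_apply,
        neg_eq_zero] at h0 h1
      fin_cases i
      · exact h1
      · exact h0
    · simp [PiLp.inner_apply, Fin.sum_univ_two]
      ring

theorem enorm_gradient (φ : Plane → ℝ) (x : Plane) : ‖gradient φ x‖ₑ = ‖fderiv ℝ φ x‖ₑ := by
  rw [← toDual_gradient, ← ofReal_norm, ← ofReal_norm, LinearIsometryEquiv.norm_map]

theorem eLpNorm_gradient (φ : Plane → ℝ) (p : ℝ≥0∞) (μ : Measure Plane) :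
    eLpNorm (gradient φ) p μ = eLpNorm (fderiv ℝ φ) p μ :=
  eLpNorm_congr_enorm_ae (ae_of_all _ (enorm_gradient φ))

theorem IsPolygonalDomain.vertex_ne {m : ℕ} {P : Polygon Plane m} {Ω : Set Plane}
    (hΩ : IsPolygonalDomain P Ω) (i : Fin m) : P i ≠ P (finRotate m i) := by
  intro h
  -- A degenerate edge has a constant path, so the parameters 0 and 1/2 would give the same point.
  have := hΩ.simple i i 0 (by simp) (1 / 2) (by norm_num) (by simp [Polygon.edgePath, h])
  norm_num at this

/-- Sobolev inequality for smooth functions on a polygon, with a boundary term on the Dirichlet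
part. -/
theorem IsPolygonalDomain.exists_eLpNorm_le {m : ℕ} {P : Polygon Plane m} {Ω : Set Plane}
    (hΩ : IsPolygonalDomain P Ω) {D : Set (Fin m)} (hD : D.Nonempty) {p : ℝ} (hp : 2 ≤ p) :
    ∃ C : ℝ≥0∞, C ≠ ⊤ ∧ ∀ φ : Plane → ℝ, ContDiff ℝ 1 φ →
      eLpNorm φ (ENNReal.ofReal p) (volume.restrict Ω)
        ≤ C * (eLpNorm (gradient φ) 2 (volume.restrict Ω)
          + eLpNorm φ 2 ((μH[1] : Measure Plane).restrict (edgeUnion P D))) := by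
  -- A single Dirichlet edge suffices: enlarging it to the whole Dirichlet part only increases the
  -- boundary term.
  obtain ⟨i, hi⟩ := hD
  choose n hn hn0 using fun j => exists_ne_zero_inner_eq_zero (P (finRotate m j) - P j)
  have hv : P (finRotate m i) - P i ≠ 0 := sub_ne_zero.mpr (hΩ.vertex_ne i).symm
  have hL : 0 < ‖P (finRotate m i) - P i‖ := norm_pos_iff.mpr hv
  set e := ‖P (finRotate m i) - P i‖⁻¹ • (P (finRotate m i) - P i) with he
  have hedge : (fun s : ℝ => P i + s • e) '' Set.Icc 0 ‖P (finRotate m i) - P i‖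
      ⊆ P.edgeSet ℝ i := by
    rw [Polygon.edgeSet_eq_image_edgePath]
    rintro _ ⟨s, hs, rfl⟩
    refine ⟨s / ‖P (finRotate m i) - P i‖,
      ⟨div_nonneg hs.1 hL.le, (div_le_one hL).mpr hs.2⟩, ?_⟩
    simp only [Polygon.edgePath, AffineMap.lineMap_apply, vsub_eq_sub, vadd_eq_add, he, smul_smul,
      div_eq_mul_inv]
    exact add_comm _ _
  have hbd : P.edgeSet ℝ i ⊆ closure Ω := by
    refine (Set.subset_iUnion (fun i => P.edgeSet ℝ i) i).trans ?_
    exact (hΩ.frontier_eq.symm.subset).trans frontier_subset_closure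
  have hfr : ∀ x ∈ frontier Ω, ∃ j, inner ℝ (n j) (x - P j) = 0 := by
    intro x hx
    rw [hΩ.frontier_eq] at hx
    obtain ⟨j, hj⟩ := Set.mem_iUnion.mp hx
    rw [Polygon.edgeSet_eq_image_edgePath] at hj
    obtain ⟨t, -, rfl⟩ := hj
    refine ⟨j, ?_⟩
    simp only [Polygon.edgePath, AffineMap.lineMap_apply, vsub_eq_sub, vadd_eq_add,
      add_sub_cancel_right, inner_smul_right, hn0, mul_zero]
  obtain ⟨C, hC, h⟩ := exists_eLpNorm_le_fderiv_add_segment hΩ.isOpen hΩ.isBounded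
    hΩ.isConnected.isPreconnected n (fun j => P j) hn hfr (norm_smul_inv_norm hv) hL
    (hedge.trans hbd) hp
  refine ⟨C, hC, fun φ hφ => (h φ hφ).trans ?_⟩
  rw [eLpNorm_gradient]
  refine mul_le_mul' le_rfl (add_le_add le_rfl ?_)
  exact eLpNorm_mono_measure _ (Measure.restrict_mono (hedge.trans
    (Set.subset_biUnion_of_mem (u := fun i => P.edgeSet ℝ i) hi)) le_rfl)

theorem expo_eq_ofReal (q : ℕ) : expo q = ENNReal.ofReal (2 * ((q : ℝ) + 1)) := by
  rw [expo, ← ENNReal.ofReal_natCast]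
  push_cast
  rfl

/-- The Sobolev embedding bound on a polygon. -/
theorem IsPolygonalDomain.exists_isSobolevConstant {m : ℕ} {P : Polygon Plane m} {Ω : Set Plane}
    (hΩ : IsPolygonalDomain P Ω) {D : Set (Fin m)} (hD : D.Nonempty) (q : ℕ) :
    ∃ C : ℝ, IsSobolevConstant P D Ω q C := by
  have hq : (2 : ℝ) ≤ 2 * ((q : ℝ) + 1) := by
    have : (0 : ℝ) ≤ q := q.cast_nonneg
    linarith
  obtain ⟨C, hC, h⟩ := hΩ.exists_eLpNorm_le hD hq
  rw [← expo_eq_ofReal] at h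
  -- Adding 1 ensures positivity, since `C` may be 0.
  refine ⟨C.toReal + 1, by positivity, fun v hv => ?_⟩
  obtain ⟨-, -, -, φ, hφ, h1, h2, h3⟩ := hv
  have hmeas : ∀ n, AEStronglyMeasurable (φ n) (volume.restrict Ω) := fun n =>
    (hφ n).continuous.aestronglyMeasurable
  -- `L²` convergence yields an a.e. convergent subsequence, so Fatou bounds the `L^{2(q+1)}` norm
  -- of `v` by the limit inferior of those of the smooth functions.
  obtain ⟨ns, hns, hae⟩ := (tendstoInMeasure_of_tendsto_eLpNorm two_ne_zero hmeas
    (Lp.aestronglyMeasurable v) h1).exists_seq_tendsto_ae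
  refine (Lp.eLpNorm_lim_le_liminf_eLpNorm (fun n => hmeas (ns n)) _ hae).trans ?_
  set g := weakGrad Ω v with hg
  have hbound : ∀ n, eLpNorm (φ n) (expo q) (volume.restrict Ω)
      ≤ C * (eLpNorm (fun x => gradient (φ n) x - g x) 2 (volume.restrict Ω)
        + eLpNorm g 2 (volume.restrict Ω)
        + eLpNorm (φ n) 2 ((μH[1] : Measure Plane).restrict (edgeUnion P D))) := by
    intro n
    refine (h (φ n) ((hφ n).of_le (by exact_mod_cast le_top))).trans ?_
    gcongr
    have hgm : AEStronglyMeasurable (gradient (φ n)) (volume.restrict Ω) := by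
      refine Continuous.aestronglyMeasurable ?_
      exact (InnerProductSpace.toDual ℝ Plane).symm.continuous.comp
        ((hφ n).continuous_fderiv (by simp))
    have e : gradient (φ n) = (fun x => gradient (φ n) x - g x) + g := by
      ext x
      simp
    conv_lhs => rw [e]
    exact eLpNorm_add_le (hgm.sub (Lp.aestronglyMeasurable g)) (Lp.aestronglyMeasurable g)
      one_le_two
  have hlim : Tendsto (fun n => C * (eLpNorm (fun x => gradient (φ n) x - g x) 2
        (volume.restrict Ω) + eLpNorm g 2 (volume.restrict Ω)
        + eLpNorm (φ n) 2 ((μH[1] : Measure Plane).restrict (edgeUnion P D)))) atTop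
      (𝓝 (C * (0 + eLpNorm g 2 (volume.restrict Ω) + 0))) := by
    simp only [Pi.zero_apply, sub_zero] at h3
    exact ENNReal.Tendsto.const_mul ((h2.add tendsto_const_nhds).add h3) (Or.inr hC)
  refine (liminf_le_liminf (Eventually.of_forall fun k => hbound (ns k))).trans ?_
  refine (hlim.comp hns.tendsto_atTop).liminf_eq.trans_le ?_
  rw [zero_add, add_zero,
    ENNReal.ofReal_mul (by positivity), ofReal_norm, Lp.enorm_def]
  gcongr
  rw [ENNReal.ofReal_add ENNReal.toReal_nonneg zero_le_one, ENNReal.ofReal_toReal hC]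
  exact le_self_add

/-! ### The zero-trace space as a closed subspace -/

theorem _root_.Continuous.memLp_restrict_of_isBounded {F : Type*} [NormedAddCommGroup F]
    {f : Plane → F} [SecondCountableTopologyEither Plane F] (hf : Continuous f) {S : Set Plane}
    (hSm : MeasurableSet S) (hS : Bornology.IsBounded S) {μ : Measure Plane} (hμ : μ S ≠ ⊤)
    (p : ℝ≥0∞) : MemLp f p (μ.restrict S) := by
  have : IsFiniteMeasure (μ.restrict S) := ⟨by rw [Measure.restrict_apply_univ]; exact hμ.lt_top⟩
  obtain ⟨C, hC⟩ := hS.isCompact_closure.exists_bound_of_continuousOn hf.continuousOn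
  refine MemLp.of_bound hf.aestronglyMeasurable C ?_
  filter_upwards [ae_restrict_mem hSm] with x hx using hC x (subset_closure hx)

theorem continuous_gradient {φ : Plane → ℝ} (hφ : ContDiff ℝ ∞ φ) : Continuous (gradient φ) :=
  (InnerProductSpace.toDual ℝ Plane).symm.continuous.comp (hφ.continuous_fderiv (by simp))

theorem gradient_add_eq {φ ψ : Plane → ℝ} (hφ : ContDiff ℝ ∞ φ) (hψ : ContDiff ℝ ∞ ψ) :
    gradient (φ + ψ) = gradient φ + gradient ψ := by
  ext1 x
  simp only [gradient, Pi.add_apply]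
  rw [fderiv_add (hφ.differentiable (by simp) x) (hψ.differentiable (by simp) x), map_add]

theorem gradient_const_smul_eq (c : ℝ) {φ : Plane → ℝ} (hφ : ContDiff ℝ ∞ φ) :
    gradient (c • φ) = c • gradient φ := by
  ext1 x
  simp only [gradient, Pi.smul_apply]
  rw [fderiv_const_smul (hφ.differentiable (by simp) x), map_smulₛₗ]
  simp

/-- The space `L²(Γ)` with respect to arc length. -/
abbrev TraceSpace (Γ : Set Plane) : Type := Lp ℝ 2 ((μH[1] : Measure Plane).restrict Γ)

/-- The functions that are smooth up to the boundary, with their gradients and restrictions to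
`Γ`. -/
def smoothTriples (Ω Γ : Set Plane) : Submodule ℝ (LpSpace Ω 2 × L2Field Ω × TraceSpace Γ) where
  carrier := {z | ∃ φ : Plane → ℝ, ContDiff ℝ ∞ φ ∧ z.1 =ᵐ[volume.restrict Ω] φ ∧
    z.2.1 =ᵐ[volume.restrict Ω] gradient φ ∧ z.2.2 =ᵐ[(μH[1] : Measure Plane).restrict Γ] φ}
  add_mem' := by
    rintro z w ⟨φ, hφ, h1, h2, h3⟩ ⟨ψ, hψ, k1, k2, k3⟩
    refine ⟨φ + ψ, hφ.add hψ, (Lp.coeFn_add _ _).trans (h1.add k1), ?_,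
      (Lp.coeFn_add _ _).trans (h3.add k3)⟩
    rw [gradient_add_eq hφ hψ]
    exact (Lp.coeFn_add _ _).trans (h2.add k2)
  zero_mem' := by
    refine ⟨0, contDiff_const, Lp.coeFn_zero _ _ _, ?_, Lp.coeFn_zero _ _ _⟩
    refine (Lp.coeFn_zero _ _ _).trans (ae_of_all _ fun x => ?_)
    simp [gradient]
  smul_mem' := by
    rintro c z ⟨φ, hφ, h1, h2, h3⟩
    refine ⟨c • φ, hφ.const_smul c, (Lp.coeFn_smul _ _).trans (h1.const_smul c), ?_,
      (Lp.coeFn_smul _ _).trans (h3.const_smul c)⟩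
    rw [gradient_const_smul_eq c hφ]
    exact (Lp.coeFn_smul _ _).trans (h2.const_smul c)

/-- The pairs `(u, G)` with `G` the weak gradient of `u`. -/
def weakGradientGraph (Ω : Set Plane) : Submodule ℝ (LpSpace Ω 2 × L2Field Ω) :=
  ⨅ (φ : {φ : Plane → ℝ // ContDiff ℝ ∞ φ ∧ HasCompactSupport φ ∧ tsupport φ ⊆ Ω}) (j : Fin 2)
    (a : {a : LpSpace Ω 2 × L2Field Ω // (a.1 =ᵐ[volume.restrict Ω]
      fun x => fderiv ℝ φ.1 x (EuclideanSpace.single j 1)) ∧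
      a.2 =ᵐ[volume.restrict Ω] fun x => φ.1 x • EuclideanSpace.single j (1 : ℝ)}),
    ((innerSL ℝ a.1.1).comp (ContinuousLinearMap.fst ℝ _ _)
      + (innerSL ℝ a.1.2).comp (ContinuousLinearMap.snd ℝ _ _)).ker

theorem isClosed_weakGradientGraph (Ω : Set Plane) :
    IsClosed (weakGradientGraph Ω : Set (LpSpace Ω 2 × L2Field Ω)) := by
  simp only [weakGradientGraph, Submodule.coe_iInf]
  exact isClosed_iInter fun φ => isClosed_iInter fun j => isClosed_iInter fun a =>
    ContinuousLinearMap.isClosed_ker _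

/-- The functionals in the graph are indexed by `L²` classes representing the test data, so each
direction only needs the inner products rewritten as integrals; compact support supplies a
representative. -/
theorem mem_weakGradientGraph {Ω : Set Plane} {u : LpSpace Ω 2} {G : L2Field Ω} :
    (u, G) ∈ weakGradientGraph Ω ↔ IsWeakGradient Ω u G := by
  have key : ∀ (φ : Plane → ℝ) (j : Fin 2) (a : LpSpace Ω 2 × L2Field Ω),
      (a.1 =ᵐ[volume.restrict Ω] fun x => fderiv ℝ φ x (EuclideanSpace.single j 1)) →
      (a.2 =ᵐ[volume.restrict Ω] fun x => φ x • EuclideanSpace.single j (1 : ℝ)) →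
      (inner ℝ a.1 u + inner ℝ a.2 G = 0 ↔
        ∫ x in Ω, u x * fderiv ℝ φ x (EuclideanSpace.single j 1) = - ∫ x in Ω, G x j * φ x) := by
    intro φ j a h1 h2
    have e1 : inner ℝ a.1 u = ∫ x in Ω, u x * fderiv ℝ φ x (EuclideanSpace.single j 1) := by
      rw [L2.inner_def]
      refine integral_congr_ae ?_
      filter_upwards [h1] with x hx
      rw [hx]
      simp
    have e2 : inner ℝ a.2 G = ∫ x in Ω, G x j * φ x := by
      rw [L2.inner_def]
      refine integral_congr_ae ?_
      filter_upwards [h2] with x hx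
      rw [hx, inner_smul_left, EuclideanSpace.inner_single_left]
      simp [mul_comm]
    rw [e1, e2]
    exact add_eq_zero_iff_eq_neg
  simp only [weakGradientGraph, Submodule.mem_iInf, LinearMap.mem_ker]
  constructor
  · intro h φ hφ hc hs j
    have m1 : MemLp (fun x => fderiv ℝ φ x (EuclideanSpace.single j 1)) 2
        (volume.restrict Ω : Measure Plane) := by
      refine Continuous.memLp_of_hasCompactSupport
        ((hφ.continuous_fderiv (by simp)).clm_apply continuous_const) ?_
      exact hc.fderiv_apply ℝ _
    have m2 : MemLp (fun x => φ x • EuclideanSpace.single j (1 : ℝ)) 2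
        (volume.restrict Ω : Measure Plane) :=
      (hφ.continuous.smul continuous_const).memLp_of_hasCompactSupport hc.smul_right
    refine (key φ j (m1.toLp, m2.toLp) m1.coeFn_toLp m2.coeFn_toLp).mp ?_
    exact h ⟨φ, hφ, hc, hs⟩ j ⟨(m1.toLp, m2.toLp), m1.coeFn_toLp, m2.coeFn_toLp⟩
  · rintro h ⟨φ, hφ, hc, hs⟩ j ⟨a, h1, h2⟩
    exact (key φ j a h1 h2).mpr (h φ hφ hc hs j)

/-- The pairs `(u, ∇u)` with `u ∈ H¹(Ω)` of zero trace on `Γ`. -/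
def zeroTraceGraph (Ω Γ : Set Plane) : Submodule ℝ (LpSpace Ω 2 × L2Field Ω) :=
  weakGradientGraph Ω ⊓ (smoothTriples Ω Γ).topologicalClosure.comap
    ((ContinuousLinearMap.fst ℝ (LpSpace Ω 2) (L2Field Ω)).prod
      ((ContinuousLinearMap.snd ℝ (LpSpace Ω 2) (L2Field Ω)).prod
        (0 : LpSpace Ω 2 × L2Field Ω →L[ℝ] TraceSpace Γ))).toLinearMap

theorem isClosed_zeroTraceGraph (Ω Γ : Set Plane) :
    IsClosed (zeroTraceGraph Ω Γ : Set (LpSpace Ω 2 × L2Field Ω)) := by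
  refine (isClosed_weakGradientGraph Ω).inter ?_
  exact (Submodule.isClosed_topologicalClosure _).preimage (ContinuousLinearMap.continuous _)

/-- Closure in the product of three `L²` spaces is exactly the approximation demanded by `HasTrace`,
and uniqueness of weak gradients identifies `G`. Linearity and completeness of the zero-trace space
are thereby read off from the graph. -/
theorem mem_zeroTraceGraph_iff {Ω Γ : Set Plane} (hΩ : IsOpen Ω) (hΩb : Bornology.IsBounded Ω)
    (hΓm : MeasurableSet Γ) (hΓb : Bornology.IsBounded Γ) (hΓ : (μH[1] : Measure Plane) Γ ≠ ⊤)
    {u : LpSpace Ω 2} {G : L2Field Ω} :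
    (u, G) ∈ zeroTraceGraph Ω Γ ↔ HasTrace Ω Γ u 0 ∧ weakGrad Ω u = G := by
  have hmem : (u, G) ∈ zeroTraceGraph Ω Γ ↔ IsWeakGradient Ω u G ∧
      (u, G, (0 : TraceSpace Γ)) ∈ closure (smoothTriples Ω Γ : Set _) := by
    rw [zeroTraceGraph, Submodule.mem_inf, mem_weakGradientGraph]
    exact Iff.rfl
  rw [hmem]
  constructor
  · rintro ⟨hG, hcl⟩
    have hu : u ∈ H1 Ω := ⟨G, hG⟩
    have hgr : weakGrad Ω u = G := (isWeakGradient_weakGrad hu).unique hΩ hG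
    refine ⟨⟨hu, MemLp.zero, ?_⟩, hgr⟩
    obtain ⟨z, hz, hlim⟩ := mem_closure_iff_seq_limit.mp hcl
    choose φ hφ h1 h2 h3 using hz
    refine ⟨φ, hφ, ?_, ?_, ?_⟩
    · refine ((Lp.tendsto_Lp_iff_tendsto_eLpNorm' _ _).mp
        ((continuous_fst.tendsto _).comp hlim)).congr fun n => eLpNorm_congr_ae ?_
      filter_upwards [h1 n] with x hx
      simp [hx]
    · rw [hgr]
      refine ((Lp.tendsto_Lp_iff_tendsto_eLpNorm' _ _).mp
        (((continuous_fst.comp continuous_snd).tendsto _).comp hlim)).congr fun n =>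
          eLpNorm_congr_ae ?_
      filter_upwards [h2 n] with x hx
      simp [hx]
    · refine ((Lp.tendsto_Lp_iff_tendsto_eLpNorm' _ _).mp
        (((continuous_snd.comp continuous_snd).tendsto _).comp hlim)).congr fun n =>
          eLpNorm_congr_ae ?_
      filter_upwards [h3 n, Lp.coeFn_zero ℝ 2 ((μH[1] : Measure Plane).restrict Γ)] with x hx h0
      exact congrArg₂ (fun a b : ℝ => a - b) hx h0
  · rintro ⟨⟨hu, -, φ, hφ, h1, h2, h3⟩, rfl⟩
    refine ⟨isWeakGradient_weakGrad hu, ?_⟩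
    have m1 := fun n => (hφ n).continuous.memLp_restrict_of_isBounded hΩ.measurableSet hΩb
      (μ := volume) hΩb.measure_lt_top.ne 2
    have m2 := fun n => (continuous_gradient (hφ n)).memLp_restrict_of_isBounded
      hΩ.measurableSet hΩb (μ := volume) hΩb.measure_lt_top.ne 2
    have m3 := fun n => (hφ n).continuous.memLp_restrict_of_isBounded hΓm hΓb hΓ 2
    refine mem_closure_of_tendsto (b := atTop)
      (f := fun n => ((m1 n).toLp, (m2 n).toLp, (m3 n).toLp)) ?_ (Eventually.of_forall fun n =>
        ⟨φ n, hφ n, (m1 n).coeFn_toLp, (m2 n).coeFn_toLp, (m3 n).coeFn_toLp⟩)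
    refine Tendsto.prodMk_nhds ?_ (Tendsto.prodMk_nhds ?_ ?_)
    · refine (Lp.tendsto_Lp_iff_tendsto_eLpNorm' _ _).mpr (h1.congr fun n => eLpNorm_congr_ae ?_)
      filter_upwards [(m1 n).coeFn_toLp] with x hx
      simp [hx]
    · refine (Lp.tendsto_Lp_iff_tendsto_eLpNorm' _ _).mpr (h2.congr fun n => eLpNorm_congr_ae ?_)
      filter_upwards [(m2 n).coeFn_toLp] with x hx
      simp [hx]
    · refine (Lp.tendsto_Lp_iff_tendsto_eLpNorm' _ _).mpr (h3.congr fun n => eLpNorm_congr_ae ?_)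
      filter_upwards [(m3 n).coeFn_toLp,
        Lp.coeFn_zero ℝ 2 ((μH[1] : Measure Plane).restrict Γ)] with x hx h0
      exact (congrArg₂ (fun a b : ℝ => a - b) hx h0).symm

theorem measurableSet_edgeUnion {m : ℕ} (P : Polygon Plane m) (D : Set (Fin m)) :
    MeasurableSet (edgeUnion P D) := by
  refine MeasurableSet.biUnion D.to_countable fun i _ => ?_
  rw [Polygon.edgeSet_eq_image_edgePath]
  exact (isCompact_Icc.image (P.edgePath ℝ i).continuous_of_finiteDimensional).measurableSet

theorem hausdorffMeasure_edgeUnion_ne_top {m : ℕ} (P : Polygon Plane m) (D : Set (Fin m)) :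
    (μH[1] : Measure Plane) (edgeUnion P D) ≠ ⊤ := by
  refine ((measure_biUnion_le _ D.to_countable _).trans_lt ?_).ne
  have : Fintype D := Fintype.ofFinite D
  rw [tsum_fintype]
  refine ENNReal.sum_lt_top.mpr fun i _ => ?_
  rw [Polygon.edgeSet, affineSegment_eq_segment, hausdorffMeasure_segment]
  exact edist_lt_top _ _

theorem IsPolygonalDomain.mem_zeroTraceGraph_iff {m : ℕ} {P : Polygon Plane m} {Ω : Set Plane}
    (hΩ : IsPolygonalDomain P Ω) (D : Set (Fin m)) {u : LpSpace Ω 2} {G : L2Field Ω} :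
    (u, G) ∈ zeroTraceGraph Ω (edgeUnion P D) ↔ u ∈ H1D P D Ω ∧ weakGrad Ω u = G := by
  have hb : edgeUnion P D ⊆ closure Ω := by
    refine (Set.iUnion₂_subset fun i _ => Set.subset_iUnion (fun i => P.edgeSet ℝ i) i).trans ?_
    exact (hΩ.frontier_eq.symm.subset).trans frontier_subset_closure
  rw [SemilinearBVP.mem_zeroTraceGraph_iff hΩ.isOpen hΩ.isBounded (measurableSet_edgeUnion P D)
    (hΩ.isBounded.closure.subset hb) (hausdorffMeasure_edgeUnion_ne_top P D)]
  exact ⟨fun h => ⟨⟨h.1.1, h.1⟩, h.2⟩, fun h => ⟨h.1.2, h.2⟩⟩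

/-! ### Direct method -/

/-- The direct method for a strongly convex functional. -/
theorem exists_forall_half_sq_norm_add_le {W H : Type*} [NormedAddCommGroup W] [NormedSpace ℝ W]
    [CompleteSpace W] [NormedAddCommGroup H] [InnerProductSpace ℝ H] (G : W →L[ℝ] H) {C : ℝ}
    (hC : ∀ w, ‖w‖ ≤ C * ‖G w‖) {Φ : W → ℝ} (hΦ : ConvexOn ℝ Set.univ Φ) (hΦc : Continuous Φ)
    {b : ℝ} (hb : ∀ w, b ≤ ‖G w‖ ^ 2 / 2 + Φ w) :
    ∃ w, ∀ v, ‖G w‖ ^ 2 / 2 + Φ w ≤ ‖G v‖ ^ 2 / 2 + Φ v := by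
  set J : W → ℝ := fun w => ‖G w‖ ^ 2 / 2 + Φ w with hJ
  have hJc : Continuous J := by fun_prop
  have hbdd : BddBelow (Set.range J) := ⟨b, by rintro _ ⟨w, rfl⟩; exact hb w⟩
  set μ := ⨅ w, J w with hμ
  have hμle : ∀ w, μ ≤ J w := fun w => ciInf_le hbdd w
  have hex : ∀ n : ℕ, ∃ w, J w < μ + 1 / ((n : ℝ) + 1) := fun n =>
    exists_lt_of_ciInf_lt (lt_add_of_pos_right _ (by positivity))
  choose w hw using hex
  -- Evaluate at the midpoint: convexity handles `Φ`, and the parallelogram law gains the squared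
  -- distance of the images under `G`.
  have hpar : ∀ x y, ‖G (x - y)‖ ^ 2 ≤ 4 * (J x + J y - 2 * μ) := by
    intro x y
    have h1 := hμle ((1 / 2 : ℝ) • x + (1 / 2 : ℝ) • y)
    have hconv := hΦ.2
    have h2 := hconv (Set.mem_univ x) (Set.mem_univ y) (by norm_num : (0 : ℝ) ≤ 1 / 2)
      (by norm_num : (0 : ℝ) ≤ 1 / 2) (by norm_num)
    have h3 := parallelogram_law_with_norm ℝ (G x) (G y)
    have h4 : ‖G ((1 / 2 : ℝ) • x + (1 / 2 : ℝ) • y)‖ = 1 / 2 * ‖G x + G y‖ := by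
      rw [← smul_add, map_smul, norm_smul, map_add]
      norm_num
    simp only [hJ, smul_eq_mul] at h1 h2 ⊢
    rw [h4] at h1
    rw [map_sub]
    nlinarith
  have hcau : CauchySeq w := by
    -- No sign of `C` is assumed, so the absolute value keeps the later multiplication monotone.
    have hC0 : ∀ x, ‖x‖ ≤ |C| * ‖G x‖ := fun x =>
      (hC x).trans (mul_le_mul_of_nonneg_right (le_abs_self C) (norm_nonneg _))
    refine cauchySeq_of_le_tendsto_0 (fun N : ℕ => |C| * √(8 * (1 / ((N : ℝ) + 1)))) ?_ ?_
    · intro n k N hn hk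
      rw [dist_eq_norm]
      refine (hC0 _).trans (mul_le_mul_of_nonneg_left (Real.le_sqrt_of_sq_le ?_) (abs_nonneg C))
      have e1 : 1 / ((n : ℝ) + 1) ≤ 1 / ((N : ℝ) + 1) := by gcongr
      have e2 : 1 / ((k : ℝ) + 1) ≤ 1 / ((N : ℝ) + 1) := by gcongr
      have := hpar (w n) (w k)
      have := hw n
      have := hw k
      linarith
    · have h : Tendsto (fun N : ℕ => |C| * √(8 * (1 / ((N : ℝ) + 1)))) atTop
          (𝓝 (|C| * √(8 * 0))) :=
        ((Real.continuous_sqrt.tendsto _).comp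
          (tendsto_one_div_add_atTop_nhds_zero_nat.const_mul 8)).const_mul _
      simpa using h
  obtain ⟨x, hx⟩ := cauchySeq_tendsto_of_complete hcau
  refine ⟨x, fun v => le_trans ?_ (hμle v)⟩
  have hlim : Tendsto (fun n : ℕ => μ + 1 / ((n : ℝ) + 1)) atTop (𝓝 (μ + 0)) :=
    tendsto_one_div_add_atTop_nhds_zero_nat.const_add μ
  rw [add_zero] at hlim
  exact le_of_tendsto_of_tendsto' ((hJc.tendsto x).comp hx) hlim fun n => (hw n).le

/-! ### The power nonlinearity and its Hölder pairing -/

section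

/-- The graph of an even power lies above its tangent at `a`. After scaling to `b = a y`, this is
Bernoulli's inequality for `y² = 1 + (y² - 1)` combined with `y² - 1 ≥ 2(y - 1)`. -/
theorem pow_sub_pow_le_of_even (k : ℕ) (a b : ℝ) :
    a ^ (2 * (k + 1)) - b ^ (2 * (k + 1)) ≤ 2 * (k + 1) * a ^ (2 * k + 1) * (a - b) := by
  rcases eq_or_ne a 0 with rfl | ha
  · have : 0 ≤ b ^ (2 * (k + 1)) := (even_two_mul _).pow_nonneg b
    rw [zero_pow (by omega), zero_pow (by omega)]
    linarith
  obtain ⟨y, rfl⟩ : ∃ y, b = a * y := ⟨b / a, by field_simp⟩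
  have h1 : 1 + 2 * ((k : ℝ) + 1) * (y - 1) ≤ y ^ (2 * (k + 1)) := by
    have h2 := one_add_mul_le_pow (show (-2 : ℝ) ≤ y ^ 2 - 1 by nlinarith [sq_nonneg y]) (k + 1)
    rw [pow_mul]
    push_cast at h2
    have h3 : 0 ≤ ((k : ℝ) + 1) * (y - 1) ^ 2 := by positivity
    calc _ ≤ 1 + ((k : ℝ) + 1) * (y ^ 2 - 1) := by linarith
      _ ≤ _ := by simpa using h2
  have h4 : 0 ≤ a ^ (2 * (k + 1)) := (even_two_mul _).pow_nonneg a
  have h5 := mul_le_mul_of_nonneg_left h1 h4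
  rw [mul_pow]
  have h6 : a ^ (2 * (k + 1)) = a ^ (2 * k + 1) * a := by
    rw [← pow_succ]
    congr 1
  rw [h6] at h5 ⊢
  linarith

theorem pow_sub_pow_mul_sub_nonneg_of_odd (k : ℕ) (a b : ℝ) :
    0 ≤ (a ^ (2 * k + 1) - b ^ (2 * k + 1)) * (a - b) := by
  have hm : StrictMono fun x : ℝ => x ^ (2 * k + 1) := Odd.strictMono_pow ⟨k, rfl⟩
  rcases le_total a b with h | h
  · exact mul_nonneg_of_nonpos_of_nonpos (sub_nonpos.mpr (hm.monotone h)) (sub_nonpos.mpr h)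
  · exact mul_nonneg (sub_nonneg.mpr (hm.monotone h)) (sub_nonneg.mpr h)

instance holderTriple_conjExpo_expo (q : ℕ) : ENNReal.HolderTriple (conjExpo q) (expo q) 1 where
  inv_add_inv_eq_inv := by
    have h0 : ((2 * (q + 1) : ℕ) : ℝ≥0∞) ≠ 0 := by
      exact_mod_cast (by omega : 2 * (q + 1) ≠ 0)
    have h1 : ((2 * (q + 1) : ℕ) : ℝ≥0∞) ≠ ⊤ := ENNReal.natCast_ne_top _
    rw [conjExpo, expo, ENNReal.inv_div (Or.inl (ENNReal.natCast_ne_top _)) (Or.inl (by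
      exact_mod_cast (by omega : 2 * q + 1 ≠ 0))), ← one_div, ENNReal.div_add_div_same, inv_one]
    have : ((2 * q + 1 : ℕ) : ℝ≥0∞) + 1 = ((2 * (q + 1) : ℕ) : ℝ≥0∞) := by
      exact_mod_cast (by omega : 2 * q + 1 + 1 = 2 * (q + 1))
    rw [this, ENNReal.div_self h0 h1]

instance fact_one_le_expo (q : ℕ) : Fact (1 ≤ expo q) :=
  ⟨by rw [expo]; exact_mod_cast (by omega : 1 ≤ 2 * (q + 1))⟩

instance fact_one_le_conjExpo (q : ℕ) : Fact (1 ≤ conjExpo q) := by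
  refine ⟨?_⟩
  rw [conjExpo, ENNReal.le_div_iff_mul_le (Or.inl (by exact_mod_cast (by omega : 2 * q + 1 ≠ 0)))
    (Or.inl (ENNReal.natCast_ne_top _)), one_mul]
  exact_mod_cast (by omega : 2 * q + 1 ≤ 2 * (q + 1))

theorem expo_ne_zero (q : ℕ) : expo q ≠ 0 := by
  rw [expo]
  exact_mod_cast (by omega : 2 * (q + 1) ≠ 0)

theorem expo_ne_top (q : ℕ) : expo q ≠ ⊤ := ENNReal.natCast_ne_top _

variable {X : Type*} [MeasurableSpace X] {μ : Measure X} {q : ℕ} {u v : X → ℝ}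

/-- The conjugate exponent is `2(q+1)` divided by the power `2q+1`. -/
theorem memLp_pow_conjExpo (hu : MemLp u (expo q) μ) :
    MemLp (fun x => u x ^ (2 * q + 1)) (conjExpo q) μ := by
  have h := hu.norm_rpow_div ((2 * q + 1 : ℕ) : ℝ≥0∞)
  rw [ENNReal.toReal_natCast] at h
  refine (memLp_congr_norm ?_ h.1 (ae_of_all _ fun x => ?_)).mpr h
  · exact (hu.1.aemeasurable.pow_const _).aestronglyMeasurable
  · rw [Real.rpow_natCast, norm_pow, norm_pow, norm_norm]

theorem integrable_pow_mul (hu : MemLp u (expo q) μ) (hv : MemLp v (expo q) μ) :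
    Integrable (fun x => u x ^ (2 * q + 1) * v x) μ :=
  (memLp_pow_conjExpo hu).integrable_mul hv

theorem integrable_pow_even (hu : MemLp u (expo q) μ) :
    Integrable (fun x => u x ^ (2 * (q + 1))) μ :=
  (integrable_pow_mul hu hu).congr (ae_of_all _ fun x => (pow_succ (u x) (2 * q + 1)).symm)

theorem norm_pow_expo (x : Lp ℝ (expo q) μ) :
    ‖x‖ ^ (2 * (q + 1)) = ∫ a, x a ^ (2 * (q + 1)) ∂μ := by
  have e : (expo q).toReal = ((2 * (q + 1) : ℕ) : ℝ) := by rw [expo, ENNReal.toReal_natCast]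
  have hI : ∀ a, ‖x a‖ ^ (expo q).toReal = x a ^ (2 * (q + 1)) := fun a => by
    rw [e, Real.rpow_natCast, Real.norm_eq_abs, Even.pow_abs (even_two_mul _)]
  have h0 : 0 ≤ ∫ a, x a ^ (2 * (q + 1)) ∂μ :=
    integral_nonneg fun a => (even_two_mul _).pow_nonneg _
  rw [Lp.norm_def, (Lp.memLp x).eLpNorm_eq_integral_rpow_norm (expo_ne_zero q) (expo_ne_top q)]
  simp only [hI]
  rw [e, ENNReal.toReal_ofReal (Real.rpow_nonneg h0 _), Real.rpow_inv_natCast_pow h0 (by omega)]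

/-- The tangent is taken at the perturbed point `u + t v`, so the increment is bounded above by an
integral whose limit as `t` tends to 0 is available; no derivative under the integral is needed. -/
theorem integral_pow_add_smul_sub_le (hu : MemLp u (expo q) μ) (hv : MemLp v (expo q) μ) (t : ℝ) :
    (∫ x, (u x + t * v x) ^ (2 * (q + 1)) ∂μ) - ∫ x, u x ^ (2 * (q + 1)) ∂μ
      ≤ 2 * (q + 1) * (t * ∫ x, (u x + t * v x) ^ (2 * q + 1) * v x ∂μ) := by
  have hw : MemLp (fun x => u x + t * v x) (expo q) μ := hu.add (hv.const_mul t)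
  rw [← integral_sub (integrable_pow_even hw) (integrable_pow_even hu), ← integral_const_mul,
    ← integral_const_mul]
  refine integral_mono ((integrable_pow_even hw).sub (integrable_pow_even hu))
    (((integrable_pow_mul hw hv).const_mul t).const_mul _) fun x => ?_
  refine (pow_sub_pow_le_of_even q _ _).trans (le_of_eq ?_)
  ring

theorem tendsto_integral_pow_add_smul_mul (hu : MemLp u (expo q) μ) (hv : MemLp v (expo q) μ) :
    Tendsto (fun t : ℝ => ∫ x, (u x + t * v x) ^ (2 * q + 1) * v x ∂μ) (𝓝[>] 0)
      (𝓝 (∫ x, u x ^ (2 * q + 1) * v x ∂μ)) := by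
  have hb : MemLp (fun x => |u x| + |v x|) (expo q) μ := hu.norm.add hv.norm
  -- For `0 < t ≤ 1` the integrand is dominated by `(|u| + |v|)^{2q+1} |v|`, integrable by Hölder.
  refine tendsto_integral_filter_of_dominated_convergence
    (fun x => (|u x| + |v x|) ^ (2 * q + 1) * |v x|) ?_ ?_ (integrable_pow_mul hb hv.norm) ?_
  · exact Eventually.of_forall fun t =>
      (integrable_pow_mul (hu.add (hv.const_mul t)) hv).aestronglyMeasurable
  · filter_upwards [Ioc_mem_nhdsGT (zero_lt_one' ℝ)] with t ht
    refine ae_of_all _ fun x => ?_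
    rw [norm_mul, norm_pow]
    refine mul_le_mul_of_nonneg_right (pow_le_pow_left₀ (norm_nonneg _) ?_ _) (norm_nonneg _)
    refine (norm_add_le _ _).trans (add_le_add le_rfl ?_)
    rw [norm_mul, Real.norm_of_nonneg ht.1.le]
    exact mul_le_of_le_one_left (norm_nonneg _) ht.2
  · refine ae_of_all _ fun x => ?_
    have hc : Continuous fun t : ℝ => (u x + t * v x) ^ (2 * q + 1) * v x := by fun_prop
    have h := hc.tendsto 0
    simp only [zero_mul, add_zero] at h
    exact h.mono_left nhdsWithin_le_nhds

theorem integrable_mul_conjExpo (f : Lp ℝ (conjExpo q) μ) (hv : MemLp v (expo q) μ) :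
    Integrable (fun x => f x * v x) μ :=
  (Lp.memLp f).integrable_mul hv

theorem abs_integral_mul_le (f : Lp ℝ (conjExpo q) μ) (hv : MemLp v (expo q) μ) :
    |∫ x, f x * v x ∂μ| ≤ ‖f‖ * (eLpNorm v (expo q) μ).toReal := by
  have hi := integrable_mul_conjExpo f hv
  have h1 := eLpNorm_smul_le_mul_eLpNorm (p := conjExpo q) (q := expo q) (r := 1) hv.1 (Lp.memLp f).1
  have h2 : |∫ x, f x * v x ∂μ| ≤ (eLpNorm (fun x => f x * v x) 1 μ).toReal := by
    rw [eLpNorm_one_eq_lintegral_enorm, ← integral_norm_eq_lintegral_enorm hi.1]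
    exact norm_integral_le_integral_norm (μ := μ) fun x => f x * v x
  refine h2.trans ?_
  rw [Lp.norm_def, ← ENNReal.toReal_mul]
  exact ENNReal.toReal_mono (ENNReal.mul_ne_top (Lp.memLp f).2.ne hv.2.ne) h1

/-- The functional `∫ f ·` on `L^{2(q+1)}`. -/
def integralPairing (f : Lp ℝ (conjExpo q) μ) : Lp ℝ (expo q) μ →L[ℝ] ℝ :=
  LinearMap.mkContinuous
    { toFun := fun x => ∫ a, f a * x a ∂μ
      map_add' := fun x y => by
        rw [← integral_add (integrable_mul_conjExpo f (Lp.memLp x))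
          (integrable_mul_conjExpo f (Lp.memLp y))]
        refine integral_congr_ae ?_
        filter_upwards [Lp.coeFn_add x y] with a ha
        rw [ha]
        simp [mul_add]
      map_smul' := fun c x => by
        rw [RingHom.id_apply, smul_eq_mul, ← integral_const_mul]
        refine integral_congr_ae ?_
        filter_upwards [Lp.coeFn_smul c x] with a ha
        rw [ha]
        simp [mul_left_comm] } ‖f‖ fun x => by
    rw [Lp.norm_def x]
    exact abs_integral_mul_le f (Lp.memLp x)

theorem integralPairing_apply (f : Lp ℝ (conjExpo q) μ) (x : Lp ℝ (expo q) μ) :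
    integralPairing f x = ∫ a, f a * x a ∂μ := rfl

end

/-! ### Existence, uniqueness and stability -/

section

variable {m : ℕ} {P : Polygon Plane m} {D : Set (Fin m)} {Ω : Set Plane} {q : ℕ}

theorem IsSobolevConstant.memLp {C : ℝ} (hC : IsSobolevConstant P D Ω q C) {v : LpSpace Ω 2}
    (hv : v ∈ H1D P D Ω) : MemLp v (expo q) (volume.restrict Ω) :=
  ⟨Lp.aestronglyMeasurable v, (hC.2 v hv).trans_lt ENNReal.ofReal_lt_top⟩

theorem IsSobolevConstant.toReal_eLpNorm_le {C : ℝ} (hC : IsSobolevConstant P D Ω q C)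
    {v : LpSpace Ω 2} (hv : v ∈ H1D P D Ω) :
    (eLpNorm v (expo q) (volume.restrict Ω)).toReal ≤ C * ‖weakGrad Ω v‖ :=
  ENNReal.toReal_le_of_le_ofReal (mul_nonneg hC.1.le (norm_nonneg _)) (hC.2 v hv)

theorem expo_zero : expo 0 = 2 := by
  simp [expo]

theorem formA_eq_inner (v w : LpSpace Ω 2) :
    formA Ω v w = inner ℝ (weakGrad Ω v) (weakGrad Ω w) :=
  (L2.inner_def _ _).symm

/-- The embedding of the zero trace functions into `L^{2(q+1)}(Ω)`. -/
theorem IsPolygonalDomain.exists_embedding (hΩ : IsPolygonalDomain P Ω) {C : ℝ}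
    (hC : IsSobolevConstant P D Ω q C) :
    ∃ S : zeroTraceGraph Ω (edgeUnion P D) →L[ℝ] LpSpace Ω (expo q),
      (∀ w, S w =ᵐ[volume.restrict Ω] w.1.1) ∧ ∀ w, ‖S w‖ ≤ C * ‖w.1.2‖ := by
  have hmem : ∀ w : zeroTraceGraph Ω (edgeUnion P D),
      w.1.1 ∈ H1D P D Ω ∧ weakGrad Ω w.1.1 = w.1.2 := fun w =>
    (hΩ.mem_zeroTraceGraph_iff D).mp w.2
  have hL : ∀ w : zeroTraceGraph Ω (edgeUnion P D), MemLp w.1.1 (expo q) (volume.restrict Ω) :=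
    fun w => hC.memLp (hmem w).1
  have hbound : ∀ w, ‖(hL w).toLp‖ ≤ C * ‖w.1.2‖ := by
    intro w
    rw [Lp.norm_toLp, ← (hmem w).2]
    exact hC.toReal_eLpNorm_le (hmem w).1
  refine ⟨LinearMap.mkContinuous
    { toFun := fun w => (hL w).toLp
      map_add' := fun w z => by
        apply Lp.ext
        filter_upwards [(hL (w + z)).coeFn_toLp, (hL w).coeFn_toLp, (hL z).coeFn_toLp,
          Lp.coeFn_add (hL w).toLp (hL z).toLp, Lp.coeFn_add w.1.1 z.1.1] with x h1 h2 h3 h4 h5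
        rw [h1, h4, Pi.add_apply, h2, h3]
        exact h5
      map_smul' := fun c w => by
        apply Lp.ext
        filter_upwards [(hL (c • w)).coeFn_toLp, (hL w).coeFn_toLp,
          Lp.coeFn_smul c (hL w).toLp, Lp.coeFn_smul c w.1.1] with x h1 h2 h3 h4
        rw [h1, RingHom.id_apply, h3, Pi.smul_apply, h2]
        exact h4 } C fun w => ?_, fun w => (hL w).coeFn_toLp, hbound⟩
  refine (hbound w).trans (mul_le_mul_of_nonneg_left ?_ hC.1.le)
  exact norm_snd_le w.1

/-- The energy functional has a minimizer. -/
theorem IsPolygonalDomain.exists_energy_minimizer (hΩ : IsPolygonalDomain P Ω)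
    (hD : D.Nonempty) {C : ℝ} {lam : ℝ} (hlam : 0 < lam)
    (f : LpSpace Ω (conjExpo q)) (S : zeroTraceGraph Ω (edgeUnion P D) →L[ℝ] LpSpace Ω (expo q))
    (hS : ∀ w, ‖S w‖ ≤ C * ‖w.1.2‖) :
    ∃ w : zeroTraceGraph Ω (edgeUnion P D), ∀ z : zeroTraceGraph Ω (edgeUnion P D),
      ‖w.1.2‖ ^ 2 / 2 + (lam / (2 * (q + 1)) * ‖S w‖ ^ (2 * (q + 1)) - integralPairing f (S w))
        ≤ ‖z.1.2‖ ^ 2 / 2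
          + (lam / (2 * (q + 1)) * ‖S z‖ ^ (2 * (q + 1)) - integralPairing f (S z)) := by
  -- The exponent for `q = 0` is 2, so this is the Poincaré inequality: the gradient controls the
  -- norm of the graph.
  obtain ⟨C₀, hC₀⟩ := hΩ.exists_isSobolevConstant hD 0
  have : CompleteSpace (zeroTraceGraph Ω (edgeUnion P D)) :=
    (isClosed_zeroTraceGraph Ω (edgeUnion P D)).completeSpace_coe
  set G : zeroTraceGraph Ω (edgeUnion P D) →L[ℝ] L2Field Ω :=
    (ContinuousLinearMap.snd ℝ _ _).comp (zeroTraceGraph Ω (edgeUnion P D)).subtypeL with hG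
  have hcoer : ∀ w, ‖w‖ ≤ max C₀ 1 * ‖G w‖ := by
    intro w
    obtain ⟨h1, h2⟩ := (hΩ.mem_zeroTraceGraph_iff D).mp w.2
    refine norm_prod_le_iff.mpr ⟨?_, ?_⟩
    · have h3 := hC₀.toReal_eLpNorm_le h1
      rw [expo_zero, ← Lp.norm_def, h2] at h3
      exact h3.trans (mul_le_mul_of_nonneg_right (le_max_left _ _) (norm_nonneg _))
    · exact le_mul_of_one_le_left (norm_nonneg _) (le_max_right _ _)
  have hconv : ConvexOn ℝ Set.univ fun w : zeroTraceGraph Ω (edgeUnion P D) =>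
      lam / (2 * (q + 1)) * ‖S w‖ ^ (2 * (q + 1)) - integralPairing f (S w) := by
    have h1 : ConvexOn ℝ Set.univ fun x : LpSpace Ω (expo q) => ‖x‖ ^ (2 * (q + 1)) :=
      (convexOn_norm convex_univ).pow (fun x _ => norm_nonneg x) _
    have h2 : ConvexOn ℝ Set.univ fun x : LpSpace Ω (expo q) =>
        lam / (2 * (q + 1)) * ‖x‖ ^ (2 * (q + 1)) := h1.smul (by positivity)
    have h3 := h2.sub ((integralPairing f).toLinearMap.concaveOn convex_univ)
    exact h3.comp_linearMap S.toLinearMap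
  have hcont : Continuous fun w : zeroTraceGraph Ω (edgeUnion P D) =>
      lam / (2 * (q + 1)) * ‖S w‖ ^ (2 * (q + 1)) - integralPairing f (S w) := by fun_prop
  -- The lower bound comes from completing the square in `g²/2 - ‖f‖ C g`, with the power term
  -- discarded as nonnegative.
  refine exists_forall_half_sq_norm_add_le G hcoer hconv hcont (b := -(‖f‖ * C) ^ 2 / 2)
    fun w => ?_
  have h1 : integralPairing f (S w) ≤ ‖f‖ * (C * ‖G w‖) := by
    refine (le_abs_self _).trans ?_
    refine (abs_integral_mul_le f (Lp.memLp (S w))).trans ?_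
    rw [← Lp.norm_def]
    exact mul_le_mul_of_nonneg_left (hS w) (norm_nonneg f)
  have h2 : 0 ≤ lam / (2 * (q + 1)) * ‖S w‖ ^ (2 * (q + 1)) := by positivity
  nlinarith [sq_nonneg (‖G w‖ - ‖f‖ * C)]

/-- The Euler–Lagrange inequality at a minimizer of the energy functional. -/
theorem euler_lagrange_nonneg {Γ : Set Plane} {lam : ℝ} (hlam : 0 < lam)
    {f : LpSpace Ω (conjExpo q)} {S : zeroTraceGraph Ω Γ →L[ℝ] LpSpace Ω (expo q)}
    {w : zeroTraceGraph Ω Γ} (hw : ∀ z : zeroTraceGraph Ω Γ,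
      ‖w.1.2‖ ^ 2 / 2 + (lam / (2 * (q + 1)) * ‖S w‖ ^ (2 * (q + 1)) - integralPairing f (S w))
        ≤ ‖z.1.2‖ ^ 2 / 2
          + (lam / (2 * (q + 1)) * ‖S z‖ ^ (2 * (q + 1)) - integralPairing f (S z)))
    (z : zeroTraceGraph Ω Γ) :
    0 ≤ inner ℝ w.1.2 z.1.2 + lam * (∫ x in Ω, S w x ^ (2 * q + 1) * S z x)
      - integralPairing f (S z) := by
  have hlim : Tendsto (fun t : ℝ => inner ℝ w.1.2 z.1.2 + t / 2 * ‖z.1.2‖ ^ 2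
      + lam * (∫ x in Ω, (S w x + t * S z x) ^ (2 * q + 1) * S z x) - integralPairing f (S z))
      (𝓝[>] 0) (𝓝 (inner ℝ w.1.2 z.1.2 + 0 / 2 * ‖z.1.2‖ ^ 2
        + lam * (∫ x in Ω, S w x ^ (2 * q + 1) * S z x) - integralPairing f (S z))) := by
    refine Tendsto.sub_const (Tendsto.add (Tendsto.const_add _ ?_)
      ((tendsto_integral_pow_add_smul_mul (Lp.memLp (S w)) (Lp.memLp (S z))).const_mul lam)) _
    have hc : Continuous fun t : ℝ => t / 2 * ‖z.1.2‖ ^ 2 := by fun_prop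
    exact (hc.tendsto 0).mono_left nhdsWithin_le_nhds
  rw [zero_div, zero_mul, add_zero] at hlim
  refine ge_of_tendsto hlim ?_
  filter_upwards [self_mem_nhdsWithin] with t ht
  have ht0 : 0 < t := ht
  -- Minimality along `w + t z`, with the power increment replaced by its tangent bound, gives a
  -- nonnegative quantity divisible by `t`.
  have h1 := hw (w + t • z)
  have h2 : ‖(w + t • z).1.2‖ ^ 2
      = ‖w.1.2‖ ^ 2 + 2 * (t * inner ℝ w.1.2 z.1.2) + t ^ 2 * ‖z.1.2‖ ^ 2 := by
    change ‖w.1.2 + t • z.1.2‖ ^ 2 = _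
    rw [norm_add_sq_real, inner_smul_right, norm_smul, mul_pow, Real.norm_eq_abs, sq_abs]
  have h3 : ‖S (w + t • z)‖ ^ (2 * (q + 1))
      = ∫ x in Ω, (S w x + t * S z x) ^ (2 * (q + 1)) := by
    rw [norm_pow_expo, map_add, map_smul]
    refine integral_congr_ae ?_
    filter_upwards [Lp.coeFn_add (S w) (t • S z), Lp.coeFn_smul t (S z)] with x hx1 hx2
    rw [hx1, Pi.add_apply, hx2]
    rfl
  have h4 := integral_pow_add_smul_sub_le (Lp.memLp (S w)) (Lp.memLp (S z)) t
  rw [h2, h3, norm_pow_expo (S w), map_add, map_smul, map_add, map_smul, smul_eq_mul] at h1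
  set I := ∫ x in Ω, (S w x + t * S z x) ^ (2 * q + 1) * S z x
  set A := ∫ x in Ω, (S w x + t * S z x) ^ (2 * (q + 1))
  set B := ∫ x in Ω, S w x ^ (2 * (q + 1))
  have h5 : lam / (2 * (q + 1)) * (A - B) ≤ lam * (t * I) := by
    have h6 := mul_le_mul_of_nonneg_left h4 (show 0 ≤ lam / (2 * ((q : ℝ) + 1)) by positivity)
    refine h6.trans (le_of_eq ?_)
    field_simp
  have h7 : 0 ≤ t * (inner ℝ w.1.2 z.1.2 + t / 2 * ‖z.1.2‖ ^ 2 + lam * I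
      - integralPairing f (S z)) := by
    rw [mul_sub] at h5
    linarith
  exact nonneg_of_mul_nonneg_right h7 ht0

theorem IsPolygonalDomain.exists_isWeakSolution (hΩ : IsPolygonalDomain P Ω)
    (hD : D.Nonempty) {lam : ℝ} (hlam : 0 < lam) (f : LpSpace Ω (conjExpo q)) :
    ∃ u, IsWeakSolution P D Ω q lam f u := by
  obtain ⟨C, hC⟩ := hΩ.exists_isSobolevConstant hD q
  obtain ⟨S, hSae, hS⟩ := hΩ.exists_embedding hC
  obtain ⟨w, hw⟩ := hΩ.exists_energy_minimizer hD hlam f S hS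
  obtain ⟨hwD, hwG⟩ := (hΩ.mem_zeroTraceGraph_iff D).mp w.2
  refine ⟨w.1.1, hwD, fun v hv => ?_⟩
  set z : zeroTraceGraph Ω (edgeUnion P D) :=
    ⟨(v, weakGrad Ω v), (hΩ.mem_zeroTraceGraph_iff D).mpr ⟨hv, rfl⟩⟩ with hz
  have h1 := euler_lagrange_nonneg hlam hw z
  -- The expression is odd in the direction, so the opposite variation turns the inequality into an
  -- equation.
  have h2 := euler_lagrange_nonneg hlam hw (-z)
  have e1 : inner ℝ w.1.2 (-z).1.2 = -inner ℝ w.1.2 z.1.2 := inner_neg_right _ _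
  have e2 : ∫ x in Ω, S w x ^ (2 * q + 1) * S (-z) x
      = -∫ x in Ω, S w x ^ (2 * q + 1) * S z x := by
    rw [← integral_neg, map_neg]
    refine integral_congr_ae ?_
    filter_upwards [Lp.coeFn_neg (S z)] with x hx
    rw [hx, Pi.neg_apply, mul_neg]
  rw [e1, e2, map_neg, map_neg] at h2
  have e3 : formB Ω q w.1.1 v = ∫ x in Ω, S w x ^ (2 * q + 1) * S z x := by
    refine integral_congr_ae ?_
    filter_upwards [hSae w, hSae z] with x hx1 hx2
    rw [hx1, hx2]
  have e4 : ∫ x in Ω, f x * v x = integralPairing f (S z) := by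
    rw [integralPairing_apply]
    refine integral_congr_ae ?_
    filter_upwards [hSae z] with x hx
    rw [hx]
  rw [formA_eq_inner, hwG, e3, e4]
  change inner ℝ w.1.2 z.1.2 + _ = _
  linarith

theorem IsPolygonalDomain.sub_mem_H1D (hΩ : IsPolygonalDomain P Ω) {u v : LpSpace Ω 2}
    (hu : u ∈ H1D P D Ω) (hv : v ∈ H1D P D Ω) :
    u - v ∈ H1D P D Ω ∧ weakGrad Ω (u - v) = weakGrad Ω u - weakGrad Ω v :=
  (hΩ.mem_zeroTraceGraph_iff D).mp (Submodule.sub_mem _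
    ((hΩ.mem_zeroTraceGraph_iff D).mpr ⟨hu, rfl⟩) ((hΩ.mem_zeroTraceGraph_iff D).mpr ⟨hv, rfl⟩))

/-- Test both equations with `u - v`. Monotonicity of the odd power makes the nonlinear difference
nonnegative, so the gradient of `u - v` vanishes, and Poincaré finishes. -/
theorem IsPolygonalDomain.isWeakSolution_unique (hΩ : IsPolygonalDomain P Ω) (hD : D.Nonempty)
    {lam : ℝ} (hlam : 0 < lam) {f : LpSpace Ω (conjExpo q)} {u v : LpSpace Ω 2}
    (hu : IsWeakSolution P D Ω q lam f u) (hv : IsWeakSolution P D Ω q lam f v) : u = v := by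
  obtain ⟨C, hC⟩ := hΩ.exists_isSobolevConstant hD q
  obtain ⟨C₀, hC₀⟩ := hΩ.exists_isSobolevConstant hD 0
  obtain ⟨hd, hdG⟩ := hΩ.sub_mem_H1D hu.1 hv.1
  have h1 := hu.2 _ hd
  have h2 := hv.2 _ hd
  have hB : 0 ≤ formB Ω q u (u - v) - formB Ω q v (u - v) := by
    rw [formB, formB, ← integral_sub (integrable_pow_mul (hC.memLp hu.1) (hC.memLp hd))
      (integrable_pow_mul (hC.memLp hv.1) (hC.memLp hd))]
    refine integral_nonneg_of_ae ?_
    filter_upwards [Lp.coeFn_sub u v] with x hx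
    rw [hx, Pi.sub_apply, ← sub_mul]
    exact pow_sub_pow_mul_sub_nonneg_of_odd q _ _
  have hA : formA Ω u (u - v) - formA Ω v (u - v) = ‖weakGrad Ω (u - v)‖ ^ 2 := by
    rw [formA_eq_inner, formA_eq_inner, ← inner_sub_left, ← hdG, real_inner_self_eq_norm_sq]
  have h3 : ‖weakGrad Ω (u - v)‖ ^ 2 ≤ 0 := by
    have := mul_nonneg hlam.le hB
    rw [mul_sub] at this
    linarith
  have h4 : ‖weakGrad Ω (u - v)‖ = 0 := by
    have := sq_nonneg ‖weakGrad Ω (u - v)‖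
    exact pow_eq_zero_iff two_ne_zero |>.mp (le_antisymm h3 this)
  have h5 := hC₀.toReal_eLpNorm_le hd
  rw [expo_zero, ← Lp.norm_def, h4, mul_zero] at h5
  exact sub_eq_zero.mp (norm_le_zero_iff.mp h5)

/-- Test with `u` itself: the nonlinear term is the integral of an even power, hence can be dropped,
and Hölder with the embedding bounds the right side. -/
theorem IsWeakSolution.norm_weakGrad_le {lam : ℝ} (hlam : 0 < lam) {f : LpSpace Ω (conjExpo q)}
    {u : LpSpace Ω 2} (hu : IsWeakSolution P D Ω q lam f u) {C : ℝ}
    (hC : IsSobolevConstant P D Ω q C) : ‖weakGrad Ω u‖ ≤ C * ‖f‖ := by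
  have h1 := hu.2 u hu.1
  rw [formA_eq_inner, real_inner_self_eq_norm_sq] at h1
  have hB : 0 ≤ formB Ω q u u := by
    refine integral_nonneg fun x => ?_
    simp only [Pi.zero_apply]
    rw [← pow_succ]
    exact (even_two_mul (q + 1)).pow_nonneg _
  have h2 : ∫ x in Ω, f x * u x ≤ ‖f‖ * (C * ‖weakGrad Ω u‖) :=
    (le_abs_self _).trans ((abs_integral_mul_le f (hC.memLp hu.1)).trans
      (mul_le_mul_of_nonneg_left (hC.toReal_eLpNorm_le hu.1) (norm_nonneg f)))
  have h3 : ‖weakGrad Ω u‖ * ‖weakGrad Ω u‖ ≤ C * ‖f‖ * ‖weakGrad Ω u‖ := by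
    have := mul_nonneg hlam.le hB
    nlinarith
  rcases (norm_nonneg (weakGrad Ω u)).eq_or_lt with h | h
  · rw [← h]
    exact mul_nonneg hC.1.le (norm_nonneg f)
  · exact le_of_mul_le_mul_right h3 h

end

end SemilinearBVP

end

theorem proposition2p1 {m : ℕ} (P : Polygon Plane m) (Ω : Set Plane) (hΩ : IsPolygonalDomain P Ω)
    (D : Set (Fin m)) (hD : D.Nonempty) (q : ℕ) :
    -- the Sobolev embedding bound holds with a constant depending only on `Ω`, `D` and `q`
    (∃ C : ℝ, IsSobolevConstant P D Ω q C) ∧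
    ∀ (lam : ℝ) (_ : 0 < lam) (f : LpSpace Ω (conjExpo q)),
      -- all integrals in the weak formulation converge absolutely
      (∀ u ∈ H1D P D Ω, ∀ v ∈ H1D P D Ω,
        IntegrableOn (fun x => inner ℝ (weakGrad Ω u x) (weakGrad Ω v x)) Ω ∧
        IntegrableOn (fun x => (u x) ^ (2 * q + 1) * v x) Ω ∧
        IntegrableOn (fun x => f x * v x) Ω) ∧
      -- existence and uniqueness
      (∃! u : LpSpace Ω 2, IsWeakSolution P D Ω q lam f u) ∧
      -- stability, with any Sobolev embedding constant
      ∀ u : LpSpace Ω 2, IsWeakSolution P D Ω q lam f u →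
        ∀ C : ℝ, IsSobolevConstant P D Ω q C → ‖weakGrad Ω u‖ ≤ C * ‖f‖ := by
  obtain ⟨C, hC⟩ := hΩ.exists_isSobolevConstant hD q
  refine ⟨⟨C, hC⟩, fun lam hlam f => ⟨fun u hu v hv => ⟨?_, ?_, ?_⟩, ?_, fun u hu C' hC' =>
    hu.norm_weakGrad_le hlam hC'⟩⟩
  · exact L2.integrable_inner _ _
  · exact integrable_pow_mul (hC.memLp hu) (hC.memLp hv)
  · exact integrable_mul_conjExpo f (hC.memLp hv)
  · obtain ⟨u, hu⟩ := hΩ.exists_isWeakSolution hD hlam f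
    exact ⟨u, hu, fun v hv => hΩ.isWeakSolution_unique hD hlam hv hu⟩
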